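/- **Setting.** A reward-mixing Markov decision process (RMMDP) with $S$ states, $A$ actions, $M$ latent contexts, finite reward set $\mathcal Z\subset[-1,1]$ and horizon $H$ consists of an initial state distribution $\nu$, a transition kernel $T$, mixing weights $w_1,\dots,w_M\ge 0$ with $\sum_m w_m=1$, and, for each context $m$ and state-action pair $(s,a)$, a reward distribution $\mu_m(s,a,\cdot)$ on $\mathcal Z$. At the start of an episode a context $m$ is drawn with probability $w_m$ and kept, unobserved, for the whole episode; then $s_1\sim\nu$, and for $t=1,\dots,H$ the agent observes $s_t$, plays an action $a_t$, and receives $r_t\sim\mu_m(s_t,a_t,\cdot)$, after which $s_{t+1}\sim T(\cdot\mid s_t,a_t)$. A policy $\pi$ is a function mapping the past states, actions and rewards of the episode together with the current state to an action; $V^\pi=\mathbb E_\pi[\sum_{t=1}^H r_t]$, and $\pi$ is $\epsilon$-optimal if $V^\pi\ge\max_{\pi'}V^{\pi'}-\epsilon$. A $K$-episode learner is a (possibly randomized) algorithm that plays $K$ successive episodes, choosing each action on the basis of everything observed so far (previous episodes and the current one), and then returns a (possibly randomly chosen) policy. **Theorem (Lower Bound for RMMDPs).** There are universal constants $C,B,c,c_0>0$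 such that for all integers $M\ge 2$, $A\ge 2$ and $S$ with $S\ge\sqrt M$ and $SA\ge M$ there are a horizon $H\le B\sqrt M\,(1+\log_A S)$ and a class $\mathcal C$ of RMMDPs with $S$ states, $A$ actions, $M$ contexts and rewards in $\{0,1\}$, all with the same deterministic initial state and the same deterministic transitions, with the following property. If $0<\epsilon<M^{-C\sqrt M}$ and some $K$-episode learner returns, for every model in $\mathcal C$ with horizon $H$, an $\epsilon$-optimal policy with probability at least $2/3$, then $$K\;\ge\; c_0\,\frac{(SA)^{c\sqrt M}}{\epsilon^{2}} .$$ -/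

import Mathlib

open scoped ENNReal

namespace RewardMixing

/-- A reward-mixing Markov decision process with finite state space `S`, finite action space `A`,
finite set of reward values `Z ⊆ [-1, 1]` and `M` latent contexts.  The initial distribution and the
transition kernel are common to all contexts; at the start of an episode the latent context `m` is
drawn from `weight`, and `reward m s a` is the law of the reward of the pair `(s, a)` in context
`m`. -/
structure RMMDP (S A : Type) (Z : Finset ℝ) (M : ℕ) where
  reward_bounded : ∀ z ∈ Z, |z| ≤ 1
  init : PMF S
  trans : S → A → PMF S
  weight : PMF (Fin M)
  reward : Fin M → S → A → PMF Z

/-- One time step of an episode: state, action taken, reward received. -/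
abbrev Step (S A : Type) (Z : Finset ℝ) : Type := S × A × Z

/-- An observed episode of length `H`; the latent context is not part of it. -/
abbrev Trajectory (S A : Type) (Z : Finset ℝ) (H : ℕ) : Type := Fin H → Step S A Z

/-- A deterministic history-dependent policy: the action is a function of the past steps
(oldest first) of the current episode and of the current state. -/
abbrev Policy (S A : Type) (Z : Finset ℝ) : Type := List (Step S A Z) → S → A

/-- A randomized history-dependent rule for choosing actions. -/
abbrev RandomizedPolicy (S A : Type) (Z : Finset ℝ) : Type := List (Step S A Z) → S → PMF A

section Law

variable {S A : Type} {Z : Finset ℝ} {M : ℕ}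

/-- A deterministic policy, seen as a randomized one. -/
noncomputable def Policy.toRandomized (π : Policy S A Z) : RandomizedPolicy S A Z :=
  fun h s => PMF.pure (π h s)

/-- The law of the next `n` steps in context `m` under the rule `π`, when the steps `h` have already
been made in this episode and the current state is `s`. -/
noncomputable def RMMDP.rollout (𝓜 : RMMDP S A Z M) (m : Fin M) (π : RandomizedPolicy S A Z) :
    (n : ℕ) → List (Step S A Z) → S → PMF (Trajectory S A Z n)
  | 0, _, _ => PMF.pure Fin.elim0
  | n + 1, h, s =>
      (π h s).bind fun a =>
      (𝓜.reward m s a).bind fun z =>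
      (𝓜.trans s a).bind fun s' =>
      (RMMDP.rollout 𝓜 m π n (h ++ [(s, a, z)]) s').map
        fun τ => (Fin.cons (s, a, z) τ : Trajectory S A Z (n + 1))

/-- The law of an observed episode of length `H` played with the rule `π`: a latent context is drawn
and stays fixed and hidden during the episode. -/
noncomputable def RMMDP.episode (𝓜 : RMMDP S A Z M) (H : ℕ) (π : RandomizedPolicy S A Z) :
    PMF (Trajectory S A Z H) :=
  𝓜.weight.bind fun m => 𝓜.init.bind fun s => 𝓜.rollout m π H [] s

/-- The expected cumulative reward of `π` over `H` time steps. -/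
noncomputable def RMMDP.value [Fintype S] [Fintype A] (𝓜 : RMMDP S A Z M) (H : ℕ)
    (π : Policy S A Z) : ℝ :=
  ∑ τ : Trajectory S A Z H,
    (𝓜.episode H π.toRandomized τ).toReal * ∑ t : Fin H, ((τ t).2.2 : ℝ)

/-- The optimal value over all history-dependent policies (the values are bounded by `H`). -/
noncomputable def RMMDP.optimalValue [Fintype S] [Fintype A] (𝓜 : RMMDP S A Z M) (H : ℕ) : ℝ :=
  ⨆ π : Policy S A Z, 𝓜.value H π

/-- `π` is `ε`-optimal. -/
def RMMDP.IsEpsOptimal [Fintype S] [Fintype A] (𝓜 : RMMDP S A Z M) (H : ℕ) (ε : ℝ)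
    (π : Policy S A Z) : Prop :=
  𝓜.optimalValue H - ε ≤ 𝓜.value H π

end Law

/-- A (possibly randomized) learning algorithm that interacts for `K` episodes of length `H`.
In each episode it chooses actions depending on the observed trajectories of all previous episodes
(oldest first), on the past of the current episode and on the current state; after `K` episodes
it returns a policy. -/
structure Learner (S A : Type) (Z : Finset ℝ) (H K : ℕ) where
  explore : List (Trajectory S A Z H) → RandomizedPolicy S A Z
  output : (Fin K → Trajectory S A Z H) → PMF (Policy S A Z)

section Learning

variable {S A : Type} {Z : Finset ℝ} {M H K : ℕ}

/-- The law of the data of the next `k` episodes after the episodes `past` have been observed. -/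
noncomputable def Learner.collect (ψ : Learner S A Z H K) (𝓜 : RMMDP S A Z M) :
    (k : ℕ) → List (Trajectory S A Z H) → PMF (Fin k → Trajectory S A Z H)
  | 0, _ => PMF.pure Fin.elim0
  | k + 1, past =>
      (𝓜.episode H (ψ.explore past)).bind fun τ =>
      (Learner.collect ψ 𝓜 k (past ++ [τ])).map
        fun D => (Fin.cons τ D : Fin (k + 1) → Trajectory S A Z H)

/-- The law of the policy that the learner returns after its `K` episodes in `𝓜`. -/
noncomputable def Learner.result (ψ : Learner S A Z H K) (𝓜 : RMMDP S A Z M) :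
    PMF (Policy S A Z) :=
  (ψ.collect 𝓜 K []).bind ψ.output

/-- On every model of the class `𝓒`, the learner returns an `ε`-optimal policy with probability at
least `2/3`. -/
def Learner.IsPAC [Fintype S] [Fintype A] (ψ : Learner S A Z H K) (𝓒 : Set (RMMDP S A Z M))
    (ε : ℝ) : Prop :=
  ∀ 𝓜 ∈ 𝓒, (2 / 3 : ℝ≥0∞) ≤ (ψ.result 𝓜).toOuterMeasure {π | 𝓜.IsEpsOptimal H ε π}

end Learning

/-- The set of reward values of a model with binary rewards. -/
noncomputable def binary : Finset ℝ := {0, 1}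

end RewardMixing

/-!
# A lower bound for learning reward-mixing Markov decision processes

**Hidden correlations.**  Let `d` be odd.  There are `d ^ 2` weighted contexts, each with a bias for
every one of `d` levels, such that over any nonempty proper set of levels the product of the biases
has mean zero, while the product over all levels has a mean `η > 0` of size up to `d ^ (-O(d))`
(`HiddenCorrelation.exists_of_odd`).  In the context `(r, l)`, with the angle `t = 2 π l / d`, every
level has a bias proportional to `cos t`, except that the level `r` has the additional factor
`1 - d sin² t` (a constant factor at one fixed level tunes `η`); the weight is proportional to
`cos⁻² t`.  Averaging over `r`, the moment over `j ≥ 1` levels becomes the sum over the `d`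
equispaced angles of the derivative of the trigonometric polynomial `cos t ^ (j - 1) * sin t` of
degree `j`.  That sum vanishes for `j < d`, and for `j = d` it picks up exactly the aliased top
harmonic.

**The hard models.**  The state runs through `d` complete trees that branch over the `A` actions,
with `d` of the order of `√M`, and the only random rewards are the coins at the `d` leaves on the
way.  A secret word `θ` of `H` actions singles out one leaf in each tree; the coin at the secret
leaf of the `i`-th tree has the `i`-th bias of the latent context, all other coins are fair.  Because
the lower moments vanish, an episode is distributed as with fair coins, up to a factor `1 ± η` on the
event that its whole action word is `θ`, the sign being the product of the signs of the `d` coins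
(`TreeLayout.episode_model_toReal`).

**Values.**  Only the last coin is predictable: averaging over it shows that the value exceeds the
constant value of the fair model by `η / 2` times the signed probability of following `θ`, with the
sign of the first `d - 1` coins (`TreeLayout.value_model`).  The best policy follows `θ` and leaves
it at the last step when that sign is negative.  The signed probabilities of two words add up to at
most the optimum for one word, so no policy is `ε`-optimal for two words once `η > 8 ε`
(`TreeLayout.secret_unique`).

**Counting.**  An `ε`-optimal policy therefore identifies `θ` among `A ^ H` words, each episode
probes a single word, and a probe carries information of order `η ^ 2`.  Bounding the expected
log-likelihood ratio from below by `-η ^ 2` times the expected number of probes, and from above by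
tangent lines of the logarithm, gives `K η ^ 2 ≥ const * A ^ H` (`card_le_of_tests`).  Finally
`η = 16 ε`, and `A ^ H` is at least a power of `S A` with exponent of the order of `√M`.
-/

namespace RewardMixing

/-! ### A mixture of product distributions whose only correlation has top degree -/

section Moments

open Real

/-- The sum of `cos (k t)` over the equispaced angles `t = 2 π r / d` vanishes below the
aliasing frequency. -/
lemma sum_cos_grid_eq_zero {d : ℕ} {k : ℤ} (hk : k ≠ 0) (hkd : |k| < d) :
    ∑ r ∈ Finset.range d, cos (k * (2 * π * r / d)) = 0 := by
  have hd : (0 : ℝ) < d := by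
    have : (0 : ℤ) < d := lt_of_le_of_lt (abs_nonneg k) hkd
    exact_mod_cast this
  have hs : sin (k * π / d) ≠ 0 := by
    intro h
    rw [sin_eq_zero_iff] at h
    obtain ⟨n, hn⟩ := h
    have h1 : (n : ℝ) * d = k := by
      field_simp at hn
      nlinarith [pi_pos]
    have h2 : n * (d : ℤ) = k := by exact_mod_cast h1
    have hn0 : n ≠ 0 := by rintro rfl; simp at h2; exact hk h2.symm
    have : |k| = |n| * d := by rw [← h2, abs_mul, Nat.abs_cast]
    have : 1 ≤ |n| := Int.one_le_abs hn0
    nlinarith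
  -- multiplied by `2 sin (k π / d)` the sum telescopes
  have htel : ∀ n : ℕ, 2 * sin (k * π / d) * ∑ r ∈ Finset.range n, cos (k * (2 * π * r / d)) =
      sin (k * π / d * (2 * n - 1)) + sin (k * π / d) := by
    intro n
    induction n with
    | zero => simp
    | succ n ih =>
      rw [Finset.sum_range_succ, mul_add, ih]
      have e1 : (k * π / d * (2 * (n + 1 : ℕ) - 1) : ℝ) = k * (2 * π * n / d) + k * π / d := by
        push_cast; ring
      have e2 : (k * π / d * (2 * n - 1) : ℝ) = k * (2 * π * n / d) - k * π / d := by ring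
      rw [e1, e2, sin_add, sin_sub]
      ring
  have h := htel d
  have e : (k * π / d * (2 * d - 1) : ℝ) = k * (2 * π) - k * π / d := by field_simp
  rw [e, sin_int_mul_two_pi_sub, neg_add_cancel, mul_eq_zero] at h
  exact h.resolve_left (mul_ne_zero two_ne_zero hs)

/-- The sum over the equispaced angles `t = 2 π r / d` of the derivative of
`cos t ^ j * sin (k t)`. -/
noncomputable def gridDeriv (d j : ℕ) (k : ℤ) : ℝ :=
  ∑ r ∈ Finset.range d,
    (k * cos (2 * π * r / d) ^ j * cos (k * (2 * π * r / d)) -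
      j * cos (2 * π * r / d) ^ (j - 1) * sin (2 * π * r / d) * sin (k * (2 * π * r / d)))

lemma gridDeriv_succ (d j : ℕ) (k : ℤ) :
    gridDeriv d (j + 1) k = (gridDeriv d j (k + 1) + gridDeriv d j (k - 1)) / 2 := by
  unfold gridDeriv
  rw [← Finset.sum_add_distrib, Finset.sum_div]
  refine Finset.sum_congr rfl fun r _ => ?_
  generalize (2 * π * r / d : ℝ) = t
  have e1 : (((k + 1 : ℤ) : ℝ) * t) = k * t + t := by push_cast; ring
  have e2 : (((k - 1 : ℤ) : ℝ) * t) = k * t - t := by push_cast; ring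
  rw [e1, e2, cos_add, cos_sub, sin_add, sin_sub]
  rcases j with _ | j
  · simp; ring
  · simp only [Nat.add_sub_cancel]; push_cast; ring

lemma gridDeriv_eq_zero {d : ℕ} (j : ℕ) (k : ℤ) (h : |k| + j < d) : gridDeriv d j k = 0 := by
  induction j generalizing k with
  | zero =>
    rcases eq_or_ne k 0 with rfl | hk
    · simp [gridDeriv]
    · simp only [gridDeriv, pow_zero, mul_one, Nat.cast_zero, zero_mul, sub_zero]
      rw [← Finset.mul_sum, sum_cos_grid_eq_zero hk (by simpa using h), mul_zero]
  | succ j ih =>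
    push_cast at h
    have h1 := abs_add_le k 1
    have h2 := abs_sub k 1
    rw [abs_one] at h1 h2
    rw [gridDeriv_succ, ih _ (by omega), ih _ (by omega)]
    simp

/-- At total frequency `d` the top harmonic is aliased to a constant, so that the sum survives. -/
lemma gridDeriv_top {d : ℕ} (j : ℕ) (k : ℤ) (hk : 1 ≤ k) (h : k + j = d) :
    gridDeriv d j k = d ^ 2 / 2 ^ j := by
  induction j generalizing k with
  | zero =>
    have hkd : k = (d : ℤ) := by simpa using h
    subst hkd
    have hd : (d : ℝ) ≠ 0 := by
      intro h0
      have : d = 0 := by exact_mod_cast h0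
      omega
    have : ∀ r : ℕ, cos (((d : ℤ) : ℝ) * (2 * π * r / d)) = 1 := by
      intro r
      have : (((d : ℤ) : ℝ) * (2 * π * r / d)) = r * (2 * π) := by push_cast; field_simp
      rw [this, cos_nat_mul_two_pi]
    simp only [gridDeriv, this]
    simp
    ring
  | succ j ih =>
    push_cast at h
    have h0 : |k - 1| + (j : ℤ) < d := by rw [abs_of_nonneg (by omega)]; omega
    rw [gridDeriv_succ, ih _ (by omega) (by omega), gridDeriv_eq_zero _ _ h0, pow_succ]
    ring

lemma abs_cos_odd_mul_le (n : ℕ) (t : ℝ) :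
    |cos ((2 * n + 1 : ℕ) * t)| ≤ (2 * n + 1 : ℕ) * |cos t| := by
  induction n with
  | zero => simp
  | succ n ih =>
    have e : (((2 * (n + 1) + 1 : ℕ) : ℝ) * t) = (2 * n + 1 : ℕ) * t + 2 * t := by push_cast; ring
    rw [e, cos_add, sin_two_mul]
    set u := ((2 * n + 1 : ℕ) : ℝ) * t
    have h1 : |cos u * cos (2 * t)| ≤ |cos u| := by
      rw [abs_mul]; exact mul_le_of_le_one_right (abs_nonneg _) (abs_cos_le_one _)
    have h2 : |sin u * (2 * sin t * cos t)| ≤ 2 * |cos t| := by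
      have : |sin u| * |sin t| ≤ 1 := by
        nlinarith [abs_sin_le_one u, abs_sin_le_one t, abs_nonneg (sin u), abs_nonneg (sin t)]
      rw [abs_mul, abs_mul, abs_mul, abs_two]
      nlinarith [abs_nonneg (cos t)]
    have h3 := abs_sub (cos u * cos (2 * t)) (sin u * (2 * sin t * cos t))
    push_cast at ih ⊢
    linarith

/-- For odd `d` the equispaced angles stay away from the zeros of the cosine. -/
lemma one_le_mul_abs_cos_grid {d : ℕ} (hd : Odd d) (r : ℕ) :
    1 ≤ d * |cos (2 * π * r / d)| := by
  obtain ⟨n, rfl⟩ := hd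
  refine le_trans (le_of_eq ?_) (abs_cos_odd_mul_le n _)
  have : (((2 * n + 1 : ℕ) : ℝ) * (2 * π * r / (2 * n + 1 : ℕ))) = r * (2 * π) := by
    field_simp
  rw [this, cos_nat_mul_two_pi, abs_one]

/-- Latent contexts with a bias in `[-1, 1]` for each of `d` levels such that the biases of the
levels in `T` have mean product `0` for every nonempty proper `T`, whereas the product over all
levels has mean `η`. -/
structure HiddenCorrelation (M d : ℕ) (η : ℝ) where
  weight : PMF (Fin M)
  bias : Fin M → Fin d → ℝ
  abs_bias_le : ∀ m i, |bias m i| ≤ 1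
  moment : ∀ T : Finset (Fin d), ∑ m, (weight m).toReal * ∏ i ∈ T, bias m i =
    if T = ∅ then 1 else if T = Finset.univ then η else 0

/-- It is enough to find the contexts in an index type with at most `M` elements: the remaining
contexts get weight `0`. -/
lemma HiddenCorrelation.nonempty_of_index {ι : Type} [Fintype ι] {M d : ℕ} {η : ℝ}
    (hM : Fintype.card ι ≤ M) (w : ι → ℝ) (hw : ∀ x, 0 ≤ w x) (p : ι → Fin d → ℝ)
    (hp : ∀ x i, |p x i| ≤ 1)
    (hm : ∀ T : Finset (Fin d), ∑ x, w x * ∏ i ∈ T, p x i =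
      if T = ∅ then 1 else if T = Finset.univ then η else 0) :
    Nonempty (HiddenCorrelation M d η) := by
  classical
  obtain ⟨e⟩ : Nonempty (ι ↪ Fin M) := Function.Embedding.nonempty_of_card_le (by simpa using hM)
  set W : Fin M → ℝ := Function.extend e w 0 with hW
  have hWe : ∀ x, W (e x) = w x := fun x => e.injective.extend_apply _ _ _
  have hW0 : ∀ m, m ∉ Set.range e → W m = 0 := fun m hm => by
    rw [hW, Function.extend_apply' _ _ _ (by simpa using hm)]; rfl
  have hWnn : ∀ m, 0 ≤ W m := fun m => by
    by_cases h : m ∈ Set.range e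
    · obtain ⟨x, rfl⟩ := h; rw [hWe]; exact hw x
    · rw [hW0 m h]
  have hsum : ∀ G : Fin M → ℝ, ∑ m, W m * G m = ∑ x, w x * G (e x) := fun G =>
    (Fintype.sum_of_injective e e.injective _ _ (fun m hm => by rw [hW0 m hm, zero_mul])
      (fun x => by rw [hWe])).symm
  have hW1 : ∑ m, W m = 1 := by
    have h1 := hsum fun _ => 1
    have h2 := hm ∅
    simp at h1 h2
    rw [h1, h2]
  refine ⟨⟨PMF.ofFintype (fun m => ENNReal.ofReal (W m)) ?_, Function.extend e p 0, ?_, ?_⟩⟩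
  · rw [← ENNReal.ofReal_sum_of_nonneg (fun m _ => hWnn m), hW1, ENNReal.ofReal_one]
  · intro m i
    by_cases h : m ∈ Set.range e
    · obtain ⟨x, rfl⟩ := h; rw [e.injective.extend_apply]; exact hp x i
    · rw [Function.extend_apply' _ _ _ (by simpa using h)]; simp
  · intro T
    simp only [PMF.ofFintype_apply, ENNReal.toReal_ofReal (hWnn _)]
    rw [hsum]
    simp only [e.injective.extend_apply]
    exact hm T

/-- Average over the distinguished level `k` of the product over `T` of biases that are `a` at the
levels other than `k` and `a * b` at `k`. -/
lemma sum_prod_distinguished {d : ℕ} (a b : ℝ) (T : Finset (Fin d)) :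
    ∑ k, ∏ i ∈ T, (a * if i = k then b else 1) = a ^ T.card * (T.card * b + (d - T.card)) := by
  have h : ∀ k, ∏ i ∈ T, (a * if i = k then b else 1) =
      a ^ T.card * (1 + if k ∈ T then b - 1 else 0) := by
    intro k
    rw [Finset.prod_mul_distrib, Finset.prod_const, Finset.prod_ite_eq']
    split_ifs <;> ring
  simp only [h, ← Finset.mul_sum, Finset.sum_add_distrib]
  simp
  left
  ring

lemma abs_bias_factor_le {d : ℕ} (hd : 1 ≤ d) (t : ℝ) : |1 - (d : ℝ) * sin t ^ 2| ≤ (d : ℝ) := by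
  have h1 : (1 : ℝ) ≤ d := by exact_mod_cast hd
  have h2 := sin_sq_le_one t
  have h3 := sq_nonneg (sin t)
  rw [abs_le]
  constructor <;> nlinarith

/-- For odd `d` there are `d ^ 2` contexts whose only correlation has top degree.  The context
`(k, r)` distinguishes the level `k` and the angle `t = 2 π r / d`; its weight is proportional to
`(cos t)⁻²`, and the moment over `j` levels becomes the sum over the angles of the derivative of
`cos t ^ (j - 1) * sin t`, which vanishes below the aliasing frequency `d`. -/
theorem HiddenCorrelation.exists_of_odd {M d : ℕ} (hd : Odd d) (hM : d ^ 2 ≤ M) {η : ℝ}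
    (hη0 : 0 ≤ η) (hη : η * (d ^ (d + 1) * 2 ^ (d - 1)) ≤ 1) :
    Nonempty (HiddenCorrelation M d η) := by
  classical
  have hd1 : 1 ≤ d := hd.pos
  have hdR : (1 : ℝ) ≤ d := by exact_mod_cast hd1
  have hd0 : (0 : ℝ) < d := by linarith
  set t : Fin d → ℝ := fun r => 2 * π * (r : ℕ) / d with ht
  have hc : ∀ r, 1 ≤ d * |cos (t r)| := fun r => one_le_mul_abs_cos_grid hd r
  have hc0 : ∀ r, cos (t r) ≠ 0 := fun r h => by
    have := hc r; rw [h] at this; simp at this; linarith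
  set W : ℝ := ∑ r, (cos (t r) ^ 2)⁻¹ with hW
  have hWpos : 0 < W := by
    have : Nonempty (Fin d) := ⟨⟨0, hd1⟩⟩
    exact Finset.sum_pos (fun r _ => by have := hc0 r; positivity) Finset.univ_nonempty
  have hWle : W ≤ d ^ 3 := by
    calc W ≤ ∑ _r : Fin d, (d : ℝ) ^ 2 := by
          refine Finset.sum_le_sum fun r _ => ?_
          rw [inv_le_comm₀ (by have := hc0 r; positivity) (by positivity), ← sq_abs (cos _)]
          rw [inv_le_iff_one_le_mul₀ (by positivity), ← mul_pow, mul_comm]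
          exact one_le_pow₀ (hc r)
      _ = d ^ 3 := by simp; ring
  -- the value of the top moment before the rescaling of level `0`
  set Δ : ℝ := (d : ℝ)⁻¹ ^ d / W * (d ^ 2 / 2 ^ (d - 1)) with hΔ
  have hΔpos : 0 < Δ := by positivity
  have hηΔ : η ≤ Δ := by
    have h1 : Δ = d ^ 2 / (d ^ d * W * 2 ^ (d - 1)) := by
      rw [hΔ, inv_pow]; field_simp
    rw [h1, le_div_iff₀ (by positivity)]
    have h2 : η * (d ^ d * W * 2 ^ (d - 1)) ≤ η * (d ^ d * d ^ 3 * 2 ^ (d - 1)) := by gcongr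
    have h3 : η * ((d : ℝ) ^ d * d ^ 3 * 2 ^ (d - 1)) =
        η * (d ^ (d + 1) * 2 ^ (d - 1)) * d ^ 2 := by ring
    nlinarith [sq_nonneg (d : ℝ)]
  set i₀ : Fin d := ⟨0, hd1⟩ with hi₀
  set p : Fin d × Fin d → Fin d → ℝ := fun x i =>
    ((d : ℝ)⁻¹ * cos (t x.2)) * if i = x.1 then 1 - (d : ℝ) * sin (t x.2) ^ 2 else 1 with hp
  set w : Fin d × Fin d → ℝ := fun x => (d : ℝ)⁻¹ * (cos (t x.2) ^ 2)⁻¹ / W with hw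
  have hp1 : ∀ x i, |p x i| ≤ 1 := by
    intro x i
    have h1 : |if i = x.1 then 1 - (d : ℝ) * sin (t x.2) ^ 2 else 1| ≤ (d : ℝ) := by
      split_ifs
      · exact abs_bias_factor_le hd1 _
      · simpa using hdR
    simp only [hp, abs_mul]
    rw [abs_of_pos (inv_pos.2 hd0)]
    calc _ ≤ ((d : ℝ)⁻¹ * 1) * d := by gcongr; exact abs_cos_le_one _
      _ = 1 := by field_simp
  have hmom : ∀ T : Finset (Fin d), ∑ x, w x * ∏ i ∈ T, p x i =
      if T = ∅ then 1 else if T = Finset.univ then Δ else 0 := by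
    intro T
    have hin : ∀ r, ∑ k, w (k, r) * ∏ i ∈ T, p (k, r) i =
        (d : ℝ)⁻¹ ^ T.card / W *
          ((cos (t r) ^ 2)⁻¹ * cos (t r) ^ T.card * (1 - T.card * sin (t r) ^ 2)) := by
      intro r
      simp only [hw, hp, ← Finset.mul_sum]
      rw [sum_prod_distinguished, mul_pow]
      field_simp
      ring
    rw [Fintype.sum_prod_type_right]
    simp only [hin, ← Finset.mul_sum]
    split_ifs with h0 h1
    · subst h0
      simp [← hW]
      field_simp
    all_goals
      have hj : 1 ≤ T.card := Finset.card_pos.2 (Finset.nonempty_iff_ne_empty.2 h0)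
      have hgrid : ∑ r, ((cos (t r) ^ 2)⁻¹ * cos (t r) ^ T.card *
          (1 - T.card * sin (t r) ^ 2)) = gridDeriv d (T.card - 1) 1 := by
        rw [gridDeriv, Finset.sum_range]
        refine Finset.sum_congr rfl fun r _ => ?_
        have hr := hc0 r
        simp only [ht] at hr ⊢
        generalize (2 * π * ((r : ℕ) : ℝ) / d : ℝ) = u at hr ⊢
        have hs := sin_sq u
        obtain ⟨j, hj'⟩ : ∃ j, T.card = j + 1 := ⟨T.card - 1, by omega⟩
        rw [hj']
        rcases j with _ | j
        · simp [hs]; field_simp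
        · simp only [Nat.add_sub_cancel, Int.cast_one, one_mul]
          have h2 : sin u * sin u = 1 - cos u ^ 2 := by rw [← hs]; ring
          rw [mul_assoc _ (sin u) (sin u), h2, hs]
          field_simp
          push_cast
          ring
      rw [hgrid]
    · rw [h1]
      simp only [Finset.card_univ, Fintype.card_fin]
      rw [gridDeriv_top _ _ le_rfl (by push_cast [Nat.cast_sub hd1]; ring)]
    · have hlt : T.card < d := by
        have := Finset.card_lt_univ_of_notMem
          (Classical.not_forall.1 (fun h => h1 (Finset.eq_univ_iff_forall.2 h))).choose_spec
        simpa using this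
      rw [gridDeriv_eq_zero, mul_zero]
      rw [abs_one]; omega
  refine nonempty_of_index (ι := Fin d × Fin d) (by simpa [sq] using hM) w
    (fun x => by positivity) (fun x i => (if i = i₀ then η / Δ else 1) * p x i) ?_ ?_
  · intro x i
    have h1 : |if i = i₀ then η / Δ else 1| ≤ 1 := by
      split_ifs
      · rw [abs_of_nonneg (by positivity)]; exact (div_le_one hΔpos).2 hηΔ
      · simp
    rw [abs_mul]
    exact mul_le_one₀ h1 (abs_nonneg _) (hp1 x i)
  · intro T
    simp only [Finset.prod_mul_distrib, Finset.prod_ite_eq', mul_left_comm (w _),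
      ← Finset.mul_sum, hmom]
    rcases eq_or_ne T ∅ with rfl | h0
    · simp
    rw [if_neg h0]
    rcases eq_or_ne T Finset.univ with rfl | h1
    · rw [if_pos rfl, if_pos (Finset.mem_univ _), if_neg h0, if_pos rfl]
      field_simp
    · rw [if_neg h1, if_neg h0, if_neg h1, mul_zero]

end Moments

/-! ### An adaptive lower bound for finitely many perturbations of a sequential experiment -/

section Sequential

variable {X : Type}

/-- The probability of the outcomes `D` of `k` further rounds of a sequential experiment in which
`Q past` is the probability mass function of the next outcome. -/
noncomputable def seqLaw (Q : List X → X → ℝ) : (k : ℕ) → List X → (Fin k → X) → ℝ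
  | 0, _, _ => 1
  | k + 1, past, D => Q past (D 0) * seqLaw Q k (past ++ [D 0]) (Fin.tail D)

lemma sum_fin_succ_arrow {α : Type} [Fintype α] {k : ℕ} (f : (Fin (k + 1) → α) → ℝ) :
    ∑ D, f D = ∑ x : α, ∑ D : Fin k → α, f (Fin.cons x D) := by
  rw [← Fintype.sum_prod_type', ← (Fin.consEquiv fun _ => α).sum_comp]
  rfl

lemma seqLaw_cons (Q : List X → X → ℝ) (k : ℕ) (past : List X) (x : X) (D : Fin k → X) :
    seqLaw Q (k + 1) past (Fin.cons x D) = Q past x * seqLaw Q k (past ++ [x]) D := by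
  simp [seqLaw]

lemma seqLaw_nonneg {Q : List X → X → ℝ} (hQ : ∀ p x, 0 ≤ Q p x) (k : ℕ) (past : List X)
    (D : Fin k → X) : 0 ≤ seqLaw Q k past D := by
  induction k generalizing past with
  | zero => simp [seqLaw]
  | succ k ih => exact mul_nonneg (hQ _ _) (ih _ _)

lemma seqLaw_mul_prod (Q : List X → X → ℝ) (f : X → ℝ) (k : ℕ) (past : List X) (D : Fin k → X) :
    seqLaw (fun p x => Q p x * f x) k past D = seqLaw Q k past D * ∏ j, f (D j) := by
  induction k generalizing past with
  | zero => simp [seqLaw]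
  | succ k ih =>
    simp only [seqLaw, ih, Fin.prod_univ_succ, Fin.tail]
    ring

variable [Fintype X]

lemma sum_seqLaw {Q : List X → X → ℝ} (hQ : ∀ p, ∑ x, Q p x = 1) (k : ℕ) (past : List X) :
    ∑ D, seqLaw Q k past D = 1 := by
  induction k generalizing past with
  | zero => simp [seqLaw]
  | succ k ih =>
    rw [sum_fin_succ_arrow]
    simp only [seqLaw_cons, ← Finset.mul_sum, ih, mul_one, hQ]

/-- A function that is centred in every round stays centred when it is summed over the rounds. -/
lemma sum_seqLaw_mul_sum_eq_zero {Q : List X → X → ℝ} (hQ : ∀ p, ∑ x, Q p x = 1) {f : X → ℝ}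
    (hf : ∀ p, ∑ x, Q p x * f x = 0) (k : ℕ) (past : List X) :
    ∑ D, seqLaw Q k past D * ∑ j, f (D j) = 0 := by
  induction k generalizing past with
  | zero => simp
  | succ k ih =>
    rw [sum_fin_succ_arrow]
    have : ∀ x : X, ∑ D : Fin k → X, seqLaw Q (k + 1) past (Fin.cons x D) *
        ∑ j, f ((Fin.cons x D : Fin (k + 1) → X) j) = Q past x * f x := by
      intro x
      simp only [seqLaw_cons, Fin.sum_univ_succ, Fin.cons_zero, Fin.cons_succ, mul_add,
        Finset.sum_add_distrib, mul_assoc, ← Finset.mul_sum, ih, mul_zero, add_zero]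
      rw [← Finset.sum_mul, sum_seqLaw hQ, one_mul]
    simp only [this, hf]

lemma sub_sq_le_log_one_add {u : ℝ} (hu : |u| ≤ 1 / 2) : u - u ^ 2 ≤ Real.log (1 + u) := by
  obtain ⟨h1, h2⟩ := abs_le.1 hu
  have hp : 0 < 1 + u := by linarith
  rcases le_or_gt 0 u with h0 | h0
  · refine le_trans ?_ (Real.one_sub_inv_le_log_of_pos hp)
    rw [← sub_nonneg]
    have : 1 - (1 + u)⁻¹ - (u - u ^ 2) = u ^ 3 / (1 + u) := by field_simp; ring
    rw [this]; positivity
  · rw [Real.le_log_iff_exp_le hp]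
    have h3 := Real.quadratic_le_exp_of_nonneg (x := u ^ 2 - u) (by nlinarith)
    have h4 : u - u ^ 2 = -(u ^ 2 - u) := by ring
    rw [h4, Real.exp_neg, inv_le_iff_one_le_mul₀ (Real.exp_pos _)]
    refine le_trans ?_ (mul_le_mul_of_nonneg_left h3 hp.le)
    have h5 : (1 + u) * (1 + (u ^ 2 - u) + (u ^ 2 - u) ^ 2 / 2) =
        1 + u ^ 2 * ((1 + u - u ^ 2 + u ^ 3) / 2) := by ring
    have h6 : 0 ≤ 1 + u - u ^ 2 + u ^ 3 := by nlinarith [sq_nonneg u]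
    rw [h5]
    nlinarith [sq_nonneg u]

/-- A testing bound for one hypothesis: a test `φ` that accepts with probability at least `2 / 3`
under the perturbed law must either accept often under the reference law, or the reference law must
often probe the perturbation. -/
lemma log_le_of_test {Q : List X → X → ℝ} (hQ0 : ∀ p x, 0 ≤ Q p x) (hQ : ∀ p, ∑ x, Q p x = 1)
    {g : X → ℝ} (hg1 : ∀ x, |g x| ≤ 1) (hg0 : ∀ p, ∑ x, Q p x * g x = 0)
    {η : ℝ} (hη0 : 0 ≤ η) (hη : η ≤ 1 / 2) {K : ℕ} {φ : (Fin K → X) → ℝ} (hφ0 : ∀ D, 0 ≤ φ D)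
    (hφ1 : ∀ D, φ D ≤ 1)
    (hφ : 2 / 3 ≤ ∑ D, seqLaw Q K [] D * (∏ j, (1 + η * g (D j))) * φ D) :
    Real.log (3 / 2) ≤ η ^ 2 * (∑ D, seqLaw Q K [] D * ∑ j, |g (D j)|) +
      Real.log 2 * ∑ D, seqLaw Q K [] D * φ D := by
  set P := seqLaw Q K [] with hP
  have hP0 : ∀ D, 0 ≤ P D := seqLaw_nonneg hQ0 K []
  have hP1 : ∑ D, P D = 1 := sum_seqLaw hQ K []
  have hηg : ∀ x, |η * g x| ≤ 1 / 2 := fun x => by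
    rw [abs_mul, abs_of_nonneg hη0]
    nlinarith [hg1 x, abs_nonneg (g x)]
  have hfac : ∀ x, 0 < 1 + η * g x := fun x => by
    have := (abs_le.1 (hηg x)).1
    linarith
  set L : (Fin K → X) → ℝ := fun D => ∏ j, (1 + η * g (D j)) with hL
  have hL0 : ∀ D, 0 < L D := fun D => Finset.prod_pos fun j _ => hfac _
  have hPL : ∑ D, P D * L D = 1 := by
    have h1 : ∀ D, P D * L D = seqLaw (fun p x => Q p x * (1 + η * g x)) K [] D := fun D =>
      (seqLaw_mul_prod Q (fun x => 1 + η * g x) K [] D).symm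
    simp only [h1]
    refine sum_seqLaw (fun p => ?_) K []
    have : ∀ x, Q p x * (1 + η * g x) = Q p x + η * (Q p x * g x) := fun x => by ring
    simp only [this, Finset.sum_add_distrib, ← Finset.mul_sum, hQ, hg0]
    simp
  -- the log-likelihood ratio is bounded below through `u - u ^ 2 ≤ log (1 + u)`
  have hlow : -(η ^ 2 * ∑ D, P D * ∑ j, |g (D j)|) ≤ ∑ D, P D * Real.log (L D) := by
    have hc := sum_seqLaw_mul_sum_eq_zero hQ hg0 K []
    have : -(η ^ 2 * ∑ D, P D * ∑ j, |g (D j)|) =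
        ∑ D, P D * ∑ j, (η * g (D j) - η ^ 2 * |g (D j)|) := by
      simp only [Finset.sum_sub_distrib, mul_sub, ← Finset.mul_sum]
      have e1 : ∀ D, P D * (η * ∑ j, g (D j)) = η * (P D * ∑ j, g (D j)) := fun D => by ring
      have e2 : ∀ D, P D * (η ^ 2 * ∑ j, |g (D j)|) = η ^ 2 * (P D * ∑ j, |g (D j)|) :=
        fun D => by ring
      simp only [e1, e2, ← Finset.mul_sum]
      rw [hc]; ring
    rw [this]
    refine Finset.sum_le_sum fun D _ => mul_le_mul_of_nonneg_left ?_ (hP0 D)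
    rw [hL, Real.log_prod (fun j _ => (hfac _).ne')]
    refine Finset.sum_le_sum fun j _ => le_trans ?_ (sub_sq_le_log_one_add (hηg _))
    have h1 : g (D j) ^ 2 ≤ |g (D j)| := by
      rw [← sq_abs]; nlinarith [hg1 (D j), abs_nonneg (g (D j))]
    nlinarith [sq_nonneg η]
  -- tangent lines of the logarithm at `4 / 3` where the test accepts and at `2 / 3` elsewhere
  have htan : ∀ u v : ℝ, 0 < u → 0 < v → Real.log v ≤ Real.log u + v / u - 1 := by
    intro u v hu hv
    have := Real.log_le_sub_one_of_pos (div_pos hv hu)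
    rw [Real.log_div hv.ne' hu.ne'] at this
    linarith
  have hup : ∑ D, P D * Real.log (L D) ≤
      ∑ D, (Real.log 2 * (P D * φ D) + (Real.log (2 / 3) - 1) * P D + 3 / 2 * (P D * L D)
        - 3 / 4 * (P D * L D * φ D)) := by
    refine Finset.sum_le_sum fun D _ => ?_
    have h1 := htan (4 / 3) (L D) (by norm_num) (hL0 D)
    have h2 := htan (2 / 3) (L D) (by norm_num) (hL0 D)
    have h3 : Real.log (4 / 3) = Real.log 2 + Real.log (2 / 3) := by
      rw [← Real.log_mul (by norm_num) (by norm_num)]; norm_num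
    have h4 : Real.log (L D) ≤ φ D * (Real.log (4 / 3) + L D / (4 / 3) - 1) +
        (1 - φ D) * (Real.log (2 / 3) + L D / (2 / 3) - 1) := by
      nlinarith [mul_le_mul_of_nonneg_left h1 (hφ0 D),
        mul_le_mul_of_nonneg_left h2 (sub_nonneg.2 (hφ1 D))]
    have h5 := mul_le_mul_of_nonneg_left h4 (hP0 D)
    rw [h3] at h5
    linarith
  simp only [Finset.sum_sub_distrib, Finset.sum_add_distrib, ← Finset.mul_sum, hP1, hPL] at hup
  have h6 : Real.log (2 / 3) = -Real.log (3 / 2) := by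
    rw [← Real.log_inv]; norm_num
  rw [h6] at hup
  linarith

/-- If every round probes at most one of the hypotheses and a test tells them apart with error
probability at most `1 / 3`, the number of rounds is at least of the order of the number of
hypotheses over the squared size of the perturbation. -/
theorem card_le_of_tests {Θ : Type} [Fintype Θ] (hΘ : 2 ≤ Fintype.card Θ)
    {Q : List X → X → ℝ} (hQ0 : ∀ p x, 0 ≤ Q p x) (hQ : ∀ p, ∑ x, Q p x = 1)
    {g : Θ → X → ℝ} (hg1 : ∀ x, ∑ θ, |g θ x| ≤ 1) (hg0 : ∀ θ p, ∑ x, Q p x * g θ x = 0)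
    {η : ℝ} (hη0 : 0 ≤ η) (hη : η ≤ 1 / 2) {K : ℕ} {φ : Θ → (Fin K → X) → ℝ}
    (hφ0 : ∀ θ D, 0 ≤ φ θ D) (hφ1 : ∀ D, ∑ θ, φ θ D ≤ 1)
    (hφ : ∀ θ, 2 / 3 ≤ ∑ D, seqLaw Q K [] D * (∏ j, (1 + η * g θ (D j))) * φ θ D) :
    Real.log (9 / 8) / 2 * Fintype.card Θ ≤ η ^ 2 * K := by
  have h := Finset.sum_le_sum fun θ (_ : θ ∈ Finset.univ) => log_le_of_test hQ0 hQ
    (fun x => (Finset.single_le_sum (f := fun θ => |g θ x|) (fun _ _ => abs_nonneg _)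
      (Finset.mem_univ θ)).trans (hg1 x)) (hg0 θ) hη0 hη (hφ0 θ)
    (fun D => (Finset.single_le_sum (f := fun θ => φ θ D) (fun _ _ => hφ0 _ _)
      (Finset.mem_univ θ)).trans (hφ1 D)) (hφ θ)
  have hP0 : ∀ D, 0 ≤ seqLaw Q K [] D := seqLaw_nonneg hQ0 K []
  have hP1 : ∑ D, seqLaw Q K [] D = 1 := sum_seqLaw hQ K []
  rw [Finset.sum_add_distrib, ← Finset.mul_sum, ← Finset.mul_sum, Finset.sum_comm,
    Finset.sum_comm (γ := Θ)] at h
  simp only [← Finset.mul_sum, Finset.sum_const, Finset.card_univ, nsmul_eq_mul] at h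
  have hN : ∑ D, seqLaw Q K [] D * ∑ θ, ∑ j, |g θ (D j)| ≤ K := by
    calc ∑ D, seqLaw Q K [] D * ∑ θ, ∑ j, |g θ (D j)|
        ≤ ∑ D, seqLaw Q K [] D * K := by
          refine Finset.sum_le_sum fun D _ => mul_le_mul_of_nonneg_left ?_ (hP0 D)
          rw [Finset.sum_comm]
          refine (Finset.sum_le_sum fun j _ => hg1 (D j)).trans ?_
          simp
      _ = K := by rw [← Finset.sum_mul, hP1, one_mul]
  have hG : ∑ D, seqLaw Q K [] D * ∑ θ, φ θ D ≤ 1 := by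
    refine (Finset.sum_le_sum fun D _ => mul_le_mul_of_nonneg_left (hφ1 D) (hP0 D)).trans ?_
    simp [hP1]
  have hlog2 : 0 < Real.log 2 := Real.log_pos (by norm_num)
  have h98 : Real.log (9 / 8) = 2 * Real.log (3 / 2) - Real.log 2 := by
    have : (2 : ℝ) * Real.log (3 / 2) = Real.log ((3 / 2) ^ 2) := by
      rw [Real.log_pow]; norm_num
    rw [this, ← Real.log_div (by norm_num) (by norm_num)]
    norm_num
  have hc : (2 : ℝ) ≤ Fintype.card Θ := by exact_mod_cast hΘ
  rw [h98]
  nlinarith [mul_le_mul_of_nonneg_left hN (sq_nonneg η), mul_le_mul_of_nonneg_left hG hlog2.le]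

end Sequential

/-! ### The law of an episode under deterministic transitions -/

section Episode

variable {S A : Type} {Z : Finset ℝ} {M H K : ℕ}

open Classical in
lemma map_cons_apply {X : Type} {n : ℕ} (p : PMF (Fin n → X)) (x : X) (D : Fin (n + 1) → X) :
    (p.map fun τ => (Fin.cons x τ : Fin (n + 1) → X)) D =
      if D 0 = x then p (Fin.tail D) else 0 := by
  rw [PMF.map_apply]
  split_ifs with h
  · rw [tsum_eq_single (Fin.tail D)]
    · rw [if_pos]
      rw [← h, Fin.cons_self_tail]
    · intro τ hτ
      rw [if_neg]
      rintro rfl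
      exact hτ (by simp)
  · refine ENNReal.tsum_eq_zero.2 fun τ => if_neg ?_
    rintro rfl
    exact h (by simp)

/-- The first draw of a sequence fixes the branch of a `bind` over it. -/
lemma bind_map_cons_apply {X : Type} {n : ℕ} (p : PMF X) (q : X → PMF (Fin n → X))
    (D : Fin (n + 1) → X) :
    (p.bind fun x => (q x).map fun τ => (Fin.cons x τ : Fin (n + 1) → X)) D =
      p (D 0) * q (D 0) (Fin.tail D) := by
  classical
  rw [PMF.bind_apply, tsum_eq_single (D 0)]
  · rw [map_cons_apply, if_pos rfl]
  · intro x hx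
    rw [map_cons_apply, if_neg (Ne.symm hx), mul_zero]

open Classical in
/-- The part of the probability of a trajectory that does not depend on the rewards: the product of
the probabilities with which the rule `π` chooses the actions, or `0` if the states do not follow
the deterministic transitions `next`. -/
noncomputable def policyWeight (next : S → A → S) (π : RandomizedPolicy S A Z) :
    (n : ℕ) → List (Step S A Z) → S → Trajectory S A Z n → ℝ
  | 0, _, _, _ => 1
  | n + 1, h, s, τ =>
      if (τ 0).1 = s then
        (π h s (τ 0).2.1).toReal *
          policyWeight next π n (h ++ [τ 0]) (next s (τ 0).2.1) (Fin.tail τ)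
      else 0

lemma policyWeight_nonneg (next : S → A → S) (π : RandomizedPolicy S A Z) (n : ℕ)
    (h : List (Step S A Z)) (s : S) (τ : Trajectory S A Z n) :
    0 ≤ policyWeight next π n h s τ := by
  induction n generalizing h s with
  | zero => simp [policyWeight]
  | succ n ih =>
    rw [policyWeight]
    split_ifs
    · exact mul_nonneg ENNReal.toReal_nonneg (ih _ _ _)
    · exact le_rfl

lemma rollout_toReal {𝓜 : RMMDP S A Z M} {next : S → A → S}
    (hnext : ∀ s a, 𝓜.trans s a = PMF.pure (next s a)) (m : Fin M) (π : RandomizedPolicy S A Z)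
    (n : ℕ) (h : List (Step S A Z)) (s : S) (τ : Trajectory S A Z n) :
    (𝓜.rollout m π n h s τ).toReal = policyWeight next π n h s τ *
      ∏ t, (𝓜.reward m (τ t).1 (τ t).2.1 (τ t).2.2).toReal := by
  classical
  induction n generalizing h s with
  | zero =>
    have : τ = Fin.elim0 := Subsingleton.elim _ _
    subst this
    simp [RMMDP.rollout, policyWeight]
  | succ n ih =>
    have h1 : 𝓜.rollout m π (n + 1) h s τ = if (τ 0).1 = s then
        π h s (τ 0).2.1 * (𝓜.reward m s (τ 0).2.1 (τ 0).2.2 *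
          𝓜.rollout m π n (h ++ [τ 0]) (next s (τ 0).2.1) (Fin.tail τ)) else 0 := by
      simp only [RMMDP.rollout, hnext, PMF.pure_bind]
      split_ifs with hs
      · rw [PMF.bind_apply, tsum_eq_single (τ 0).2.1]
        · rw [PMF.bind_apply, tsum_eq_single (τ 0).2.2]
          · rw [map_cons_apply, if_pos (by rw [← hs])]
            congr 4
            rw [← hs]
          · intro z hz
            rw [map_cons_apply, if_neg, mul_zero]
            intro h0
            exact hz (by rw [h0])
        · intro a ha
          simp only [PMF.bind_apply, map_cons_apply]
          rw [ENNReal.tsum_eq_zero.2, mul_zero]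
          intro z
          rw [if_neg, mul_zero]
          intro h0
          exact ha (by rw [h0])
      · simp only [PMF.bind_apply, map_cons_apply]
        refine ENNReal.tsum_eq_zero.2 fun a => ?_
        rw [ENNReal.tsum_eq_zero.2, mul_zero]
        intro z
        rw [if_neg, mul_zero]
        intro h0
        exact hs (by rw [h0])
    rw [h1, policyWeight]
    split_ifs with hs
    · rw [ENNReal.toReal_mul, ENNReal.toReal_mul, ih, Fin.prod_univ_succ, hs]
      simp only [Fin.tail]
      ring
    · simp

lemma episode_toReal {𝓜 : RMMDP S A Z M} {next : S → A → S} {s₀ : S}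
    (hinit : 𝓜.init = PMF.pure s₀) (hnext : ∀ s a, 𝓜.trans s a = PMF.pure (next s a))
    (π : RandomizedPolicy S A Z) (τ : Trajectory S A Z H) :
    (𝓜.episode H π τ).toReal = policyWeight next π H [] s₀ τ *
      ∑ m, (𝓜.weight m).toReal * ∏ t, (𝓜.reward m (τ t).1 (τ t).2.1 (τ t).2.2).toReal := by
  rw [RMMDP.episode, PMF.bind_apply, tsum_fintype, ENNReal.toReal_sum
    (fun m _ => ENNReal.mul_ne_top (PMF.apply_ne_top _ _) (PMF.apply_ne_top _ _)), Finset.mul_sum]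
  refine Finset.sum_congr rfl fun m _ => ?_
  rw [hinit, PMF.pure_bind, ENNReal.toReal_mul, rollout_toReal hnext]
  ring

/-- Trajectories of positive weight follow the transitions. -/
lemma follows_of_policyWeight_ne_zero {next : S → A → S} {π : RandomizedPolicy S A Z} {n : ℕ}
    {h : List (Step S A Z)} {s : S} {τ : Trajectory S A Z n}
    (hτ : policyWeight next π n h s τ ≠ 0) :
    (∀ h0 : 0 < n, (τ ⟨0, h0⟩).1 = s) ∧
      ∀ t (ht : t + 1 < n), (τ ⟨t + 1, ht⟩).1 =
        next (τ ⟨t, t.lt_succ_self.trans ht⟩).1 (τ ⟨t, t.lt_succ_self.trans ht⟩).2.1 := by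
  induction n generalizing h s with
  | zero => exact ⟨fun h0 => absurd h0 (lt_irrefl _), fun t ht => absurd ht (Nat.not_lt_zero _)⟩
  | succ n ih =>
    rw [policyWeight] at hτ
    split_ifs at hτ with hs
    · obtain ⟨ih1, ih2⟩ := ih (right_ne_zero_of_mul hτ)
      refine ⟨fun _ => hs, fun t ht => ?_⟩
      rcases t with _ | t
      · have := ih1 (by omega)
        simp only [Fin.tail] at this
        change (τ ⟨1, ht⟩).1 = next (τ 0).1 (τ 0).2.1
        rw [hs, ← this]
        rfl
      · exact ih2 t (by omega)
    · exact absurd rfl hτ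

/-- Trajectories of positive weight under a deterministic policy follow the policy. -/
lemma action_eq_of_policyWeight_ne_zero {next : S → A → S} {π : Policy S A Z} {n : ℕ}
    {h : List (Step S A Z)} {s : S} {τ : Trajectory S A Z n}
    (hτ : policyWeight next π.toRandomized n h s τ ≠ 0) (t : Fin n) :
    (τ t).2.1 = π (h ++ (List.ofFn τ).take t) (τ t).1 := by
  classical
  induction n generalizing h s with
  | zero => exact t.elim0
  | succ n ih =>
    rw [policyWeight] at hτ
    split_ifs at hτ with hs
    · refine Fin.cases ?_ (fun t => ?_) t
      · have h1 := left_ne_zero_of_mul hτ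
        simp only [Policy.toRandomized, PMF.pure_apply] at h1
        have h2 : (τ 0).2.1 = π h s := by
          by_contra h3
          simp [h3] at h1
        simp [h2, hs]
      · have := ih (right_ne_zero_of_mul hτ) t
        simp only [Fin.tail] at this
        rw [this]
        simp [List.ofFn_succ, Fin.tail_def]
    · exact absurd rfl hτ

/-- The weight does not depend on the last reward, since no action is chosen after it. -/
lemma policyWeight_congr {next : S → A → S} {π : RandomizedPolicy S A Z} {n : ℕ}
    {h : List (Step S A Z)} {s : S} {τ τ' : Trajectory S A Z n}
    (h1 : ∀ t, (τ t).1 = (τ' t).1) (h2 : ∀ t, (τ t).2.1 = (τ' t).2.1)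
    (h3 : ∀ t : Fin n, (t : ℕ) + 1 < n → τ t = τ' t) :
    policyWeight next π n h s τ = policyWeight next π n h s τ' := by
  induction n generalizing h s with
  | zero => simp [policyWeight]
  | succ n ih =>
    simp only [policyWeight]
    rw [h1 0, h2 0]
    rcases n with _ | n
    · simp [policyWeight]
    · rw [h3 0 (by simp), ih (τ := Fin.tail τ) (τ' := Fin.tail τ') (fun t => h1 t.succ)
        (fun t => h2 t.succ) (fun t ht => h3 t.succ (by simpa using ht))]

/-- Whatever the policy, the states and actions carry total mass `1` for each sequence of
rewards. -/
lemma sum_policyWeight_mul [Fintype S] [Fintype A] (next : S → A → S) (π : RandomizedPolicy S A Z)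
    (n : ℕ) (h : List (Step S A Z)) (s : S) (g : (Fin n → Z) → ℝ) :
    ∑ τ : Trajectory S A Z n, policyWeight next π n h s τ * g (fun t => (τ t).2.2) =
      ∑ z, g z := by
  classical
  induction n generalizing h s with
  | zero =>
    simp [policyWeight]
    congr 1
    exact Subsingleton.elim _ _
  | succ n ih =>
    rw [sum_fin_succ_arrow, sum_fin_succ_arrow]
    have h1 : ∀ x : Step S A Z, ∑ τ : Trajectory S A Z n,
        policyWeight next π (n + 1) h s (Fin.cons x τ) *
          g (fun t => ((Fin.cons x τ : Trajectory S A Z (n + 1)) t).2.2) =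
        if x.1 = s then (π h s x.2.1).toReal * ∑ z : Fin n → Z, g (Fin.cons x.2.2 z) else 0 := by
      intro x
      split_ifs with hx
      · rw [← ih (h ++ [x]) (next s x.2.1), Finset.mul_sum]
        refine Finset.sum_congr rfl fun τ _ => ?_
        rw [policyWeight, Fin.cons_zero, if_pos hx, Fin.tail_cons, mul_assoc]
        congr 3
        ext t : 1
        refine Fin.cases ?_ (fun t => ?_) t <;> simp
      · refine Finset.sum_eq_zero fun τ _ => ?_
        rw [policyWeight, Fin.cons_zero, if_neg hx, zero_mul]
    simp only [h1, Fintype.sum_prod_type]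
    rw [Finset.sum_eq_single s (fun s' _ hs' => by simp [hs'])
      (fun h => absurd (Finset.mem_univ _) h)]
    simp only [if_true, ← Finset.mul_sum, ← Finset.sum_mul]
    rw [← ENNReal.toReal_sum (fun a _ => PMF.apply_ne_top _ _), 
      ← tsum_fintype (L := .unconditional _), PMF.tsum_coe]
    simp

/-- The law of the data of a learner, when every episode has the density `f` with respect to a
reference weight `Q`. -/
lemma collect_toReal {𝓜 : RMMDP S A Z M} {Q : RandomizedPolicy S A Z → Trajectory S A Z H → ℝ}
    {f : Trajectory S A Z H → ℝ} (hQ : ∀ π τ, (𝓜.episode H π τ).toReal = Q π τ * f τ)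
    (ψ : Learner S A Z H K) (k : ℕ) (past : List (Trajectory S A Z H))
    (D : Fin k → Trajectory S A Z H) :
    (ψ.collect 𝓜 k past D).toReal =
      seqLaw (fun p => Q (ψ.explore p)) k past D * ∏ j, f (D j) := by
  rw [← seqLaw_mul_prod]
  induction k generalizing past with
  | zero =>
    have : D = Fin.elim0 := Subsingleton.elim _ _
    subst this
    simp [Learner.collect, seqLaw]
  | succ k ih =>
    rw [Learner.collect, bind_map_cons_apply, ENNReal.toReal_mul, hQ, ih]
    rfl

lemma toOuterMeasure_le_one {α : Type*} (p : PMF α) (G : Set α) : p.toOuterMeasure G ≤ 1 := by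
  rw [PMF.toOuterMeasure_apply, ← p.tsum_coe]
  exact ENNReal.tsum_le_tsum fun x => Set.indicator_le_self _ _ _

lemma result_toReal [Fintype S] [Fintype A] (ψ : Learner S A Z H K) (𝓜 : RMMDP S A Z M)
    (G : Set (Policy S A Z)) :
    ((ψ.result 𝓜).toOuterMeasure G).toReal =
      ∑ D, (ψ.collect 𝓜 K [] D).toReal * ((ψ.output D).toOuterMeasure G).toReal := by
  rw [Learner.result, PMF.toOuterMeasure_bind_apply, tsum_fintype, ENNReal.toReal_sum]
  · simp
  · intro D _
    exact ENNReal.mul_ne_top (PMF.apply_ne_top _ _)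
      (ne_top_of_le_ne_top ENNReal.one_ne_top (toOuterMeasure_le_one _ _))

/-- The probabilities of pairwise disjoint sets add up to at most `1`. -/
lemma sum_toOuterMeasure_toReal_le_one {α Θ : Type*} [Fintype Θ] (p : PMF α) (G : Θ → Set α)
    (hG : ∀ x θ θ', x ∈ G θ → x ∈ G θ' → θ = θ') :
    ∑ θ, (p.toOuterMeasure (G θ)).toReal ≤ 1 := by
  classical
  rw [← ENNReal.toReal_sum
    fun θ _ => ne_top_of_le_ne_top ENNReal.one_ne_top (toOuterMeasure_le_one _ _)]
  refine ENNReal.toReal_mono ENNReal.one_ne_top (b := 1) ?_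
  simp only [PMF.toOuterMeasure_apply]
  rw [← Summable.tsum_finsetSum (fun _ _ => ENNReal.summable), ← p.tsum_coe]
  refine ENNReal.tsum_le_tsum fun x => ?_
  by_cases h : ∃ θ, x ∈ G θ
  · obtain ⟨θ, hθ⟩ := h
    rw [Finset.sum_eq_single θ]
    · exact Set.indicator_le_self _ _ _
    · intro θ' _ hne
      exact Set.indicator_of_notMem (fun h' => hne (hG x _ _ h' hθ)) _
    · simp
  · push Not at h
    simp [h]

end Episode

/-! ### Binary rewards -/

section Binary

/-- The reward value `0`. -/
noncomputable def binaryZero : binary := ⟨0, by simp [binary]⟩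

/-- The reward value `1`. -/
noncomputable def binaryOne : binary := ⟨1, by simp [binary]⟩

lemma binary_cases (z : binary) : z = binaryZero ∨ z = binaryOne := by
  obtain ⟨z, hz⟩ := z
  simp only [binary, Finset.mem_insert, Finset.mem_singleton] at hz
  rcases hz with rfl | rfl
  · exact Or.inl rfl
  · exact Or.inr rfl

lemma binaryZero_ne_binaryOne : binaryZero ≠ binaryOne := by
  intro h
  simpa [binaryZero, binaryOne] using congrArg Subtype.val h

lemma sum_binary {E : Type*} [AddCommMonoid E] (f : binary → E) :
    ∑ z, f z = f binaryZero + f binaryOne := by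
  classical
  rw [← Finset.sum_pair binaryZero_ne_binaryOne]
  refine (Finset.sum_subset (Finset.subset_univ _) fun z _ hz => ?_).symm
  rcases binary_cases z with rfl | rfl <;> simp at hz

/-- The sign of a reward: `-1` for `0` and `1` for `1`. -/
noncomputable def rewardSign (z : binary) : ℝ := 2 * (z : ℝ) - 1

@[simp] lemma rewardSign_zero : rewardSign binaryZero = -1 := by simp [rewardSign, binaryZero]

@[simp] lemma rewardSign_one : rewardSign binaryOne = 1 := by
  norm_num [rewardSign, binaryOne]

/-- The other reward value. -/
noncomputable def flipReward (z : binary) : binary :=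
  open Classical in if z = binaryZero then binaryOne else binaryZero

@[simp] lemma flipReward_zero : flipReward binaryZero = binaryOne := by simp [flipReward]

@[simp] lemma flipReward_one : flipReward binaryOne = binaryZero := by
  simp [flipReward, binaryZero_ne_binaryOne.symm]

lemma flipReward_flipReward (z : binary) : flipReward (flipReward z) = z := by
  rcases binary_cases z with rfl | rfl <;> simp

lemma coin_aux (b : ℝ) (z : binary) : 0 ≤ (1 + max (-1) (min 1 b) * rewardSign z) / 2 := by
  have h1 : -1 ≤ max (-1) (min 1 b) := le_max_left _ _
  have h2 : max (-1) (min 1 b) ≤ 1 := max_le (by norm_num) (min_le_left _ _)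
  rcases binary_cases z with rfl | rfl
  · rw [rewardSign_zero]; linarith
  · rw [rewardSign_one]; linarith

/-- A coin with values `0` and `1` whose sign has mean `b` (clamped to `[-1, 1]`). -/
noncomputable def coin (b : ℝ) : PMF binary :=
  PMF.ofFintype (fun z => ENNReal.ofReal ((1 + max (-1) (min 1 b) * rewardSign z) / 2)) (by
    rw [← ENNReal.ofReal_sum_of_nonneg fun z _ => coin_aux b z, sum_binary]
    simp
    ring)

lemma coin_toReal {b : ℝ} (hb : |b| ≤ 1) (z : binary) :
    (coin b z).toReal = (1 + b * rewardSign z) / 2 := by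
  rw [coin, PMF.ofFintype_apply, ENNReal.toReal_ofReal (coin_aux b z)]
  obtain ⟨h1, h2⟩ := abs_le.1 hb
  rw [min_eq_right h2, max_eq_right h1]

end Binary

/-! ### Blocks of trees and the models of the hard class -/

/-- An encoding, in a state space `S`, of `d` consecutive complete trees of depth `k + 1` that
branch over the actions.  The state `code t w` is reached at time `t` with the action word `w`; it
remembers the time and the actions taken since the root of the current tree. -/
structure TreeLayout (S A : Type) (d k : ℕ) where
  code : Fin (d * (k + 1)) → (Fin (d * (k + 1)) → A) → S
  code_eq_iff : ∀ t w t' w', code t w = code t' w' ↔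
    t = t' ∧ ∀ j, j < t → (j : ℕ) / (k + 1) = t / (k + 1) → w j = w' j
  root : S
  code_zero : ∀ h w, code ⟨0, h⟩ w = root

lemma TreeLayout.exists_of_sum_le {S A : Type} [Fintype S] [Fintype A] [Nonempty A] {d k : ℕ}
    (hd : 0 < d)
    (h : ∑ t : Fin (d * (k + 1)), Fintype.card A ^ ((t : ℕ) % (k + 1)) ≤ Fintype.card S) :
    Nonempty (TreeLayout S A d k) := by
  classical
  obtain ⟨e⟩ : Nonempty ((Σ t : Fin (d * (k + 1)), Fin ((t : ℕ) % (k + 1)) → A) ↪ S) :=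
    Function.Embedding.nonempty_of_card_le (by simpa using h)
  have hlt : ∀ (t : Fin (d * (k + 1))) (j : Fin ((t : ℕ) % (k + 1))),
      (t : ℕ) / (k + 1) * (k + 1) + j < t := fun t j => by
    have := Nat.div_add_mod' (t : ℕ) (k + 1)
    omega
  let f : Fin (d * (k + 1)) → (Fin (d * (k + 1)) → A) →
      Σ t : Fin (d * (k + 1)), Fin ((t : ℕ) % (k + 1)) → A :=
    fun t w => ⟨t, fun j => w ⟨(t : ℕ) / (k + 1) * (k + 1) + j, (hlt t j).trans t.2⟩⟩
  refine ⟨⟨fun t w => e (f t w), fun t w t' w' => ?_,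
    e (f ⟨0, Nat.mul_pos hd k.succ_pos⟩ fun _ => Classical.arbitrary A), fun _ w => ?_⟩⟩
  · rw [e.injective.eq_iff]
    constructor
    · intro hf
      have htt : t = t' := congrArg Sigma.fst hf
      subst htt
      refine ⟨rfl, fun j hj hb => ?_⟩
      have h1 := congrFun (eq_of_heq (Sigma.mk.inj hf).2)
        ⟨(j : ℕ) % (k + 1), by
          have h1 := Nat.div_add_mod' (j : ℕ) (k + 1)
          have h2 := Nat.div_add_mod' (t : ℕ) (k + 1)
          rw [hb] at h1
          have : (j : ℕ) < t := hj
          omega⟩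
      have h2 : (t : ℕ) / (k + 1) * (k + 1) + (j : ℕ) % (k + 1) = j := by
        rw [← hb, Nat.div_add_mod']
      simpa only [h2] using h1
    · rintro ⟨rfl, hw⟩
      refine congrArg (Sigma.mk t) (funext fun j => hw _ (hlt t j) ?_)
      have hj := j.2.trans (Nat.mod_lt (t : ℕ) k.succ_pos)
      change ((t : ℕ) / (k + 1) * (k + 1) + j) / (k + 1) = _
      rw [Nat.mul_comm, Nat.mul_add_div k.succ_pos, Nat.div_eq_of_lt hj, Nat.add_zero]
  · congr 1
    refine congrArg (Sigma.mk _) (funext fun j => ?_)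
    exact absurd j.2 (by simp)

namespace TreeLayout

variable {S A : Type} {d k M : ℕ}

open Classical in
/-- The deterministic transitions: the tree is descended along the chosen actions, and a leaf leads
to the root of the next tree. -/
noncomputable def next (L : TreeLayout S A d k) (s : S) (a : A) : S :=
  if h : ∃ s' t w, s = L.code t w ∧ w t = a ∧ ∃ ht, s' = L.code ⟨t + 1, ht⟩ w then h.choose else s

lemma next_code (L : TreeLayout S A d k) (t : Fin (d * (k + 1))) (w : Fin (d * (k + 1)) → A)
    (ht : (t : ℕ) + 1 < d * (k + 1)) :
    L.next (L.code t w) (w t) = L.code ⟨t + 1, ht⟩ w := by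
  have h : ∃ s' t' w', L.code t w = L.code t' w' ∧ w' t' = w t ∧
      ∃ ht, s' = L.code ⟨t' + 1, ht⟩ w' := ⟨_, t, w, rfl, rfl, ht, rfl⟩
  rw [next, dif_pos h]
  obtain ⟨t', w', h1, h2, ht', h3⟩ := h.choose_spec
  rw [h3]
  obtain ⟨rfl, h4⟩ := (L.code_eq_iff _ _ _ _).1 h1
  refine ((L.code_eq_iff _ _ _ _).2 ⟨rfl, fun j hj hb => ?_⟩).symm
  rcases lt_or_eq_of_le (Nat.lt_succ_iff.1 hj) with hlt | heq
  · refine h4 j hlt (le_antisymm (Nat.div_le_div_right hlt.le) ?_)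
    exact hb ▸ Nat.div_le_div_right (Nat.le_succ _)
  · have : j = t := Fin.ext heq
    rw [this, h2]

/-- The last time of the block `i`. -/
def exitTime (i : Fin d) : Fin (d * (k + 1)) := finProdFinEquiv (i, Fin.last k)

/-- A product over the ends of the blocks is a product over the blocks. -/
lemma prod_exit (f : Fin (d * (k + 1)) → ℝ) :
    ∏ t : Fin (d * (k + 1)), (if k + 1 ∣ (t : ℕ) + 1 then f t else 1) =
      ∏ i, f (exitTime i) := by
  rw [← finProdFinEquiv.prod_comp, Fintype.prod_prod_type]
  refine Finset.prod_congr rfl fun i _ => ?_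
  rw [Fin.prod_univ_castSucc, Finset.prod_eq_one, one_mul, if_pos]
  · rfl
  · simp only [finProdFinEquiv_apply_val, Fin.val_last]
    exact ⟨i + 1, by ring⟩
  · intro j _
    rw [if_neg]
    simp only [finProdFinEquiv_apply_val, Fin.val_castSucc]
    intro h
    have h1 : k + 1 ∣ (j : ℕ) + 1 := by
      have h2 : (j : ℕ) + (k + 1) * i + 1 = (j + 1) + (k + 1) * i := by ring
      rw [h2] at h
      exact (Nat.dvd_add_left (dvd_mul_right _ _)).1 h
    have := Nat.le_of_dvd (Nat.succ_pos _) h1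
    have := j.2
    omega

open Classical in
/-- The bias of the reward of `(s, a)` when the secret action word is `θ` and the bias of the block
`i` is `y i`: it is nonzero only at the end of a block that has been traversed along `θ`. -/
noncomputable def secretBias (L : TreeLayout S A d k) (θ : Fin (d * (k + 1)) → A) (y : Fin d → ℝ)
    (s : S) (a : A) : ℝ :=
  if h : ∃ i, s = L.code (exitTime i) θ ∧ a = θ (exitTime i) then y h.choose else 0

open Classical in
/-- The model with the secret action word `θ`: rewards within a block are `0`, and the reward at the
end of a block is a coin, which is fair unless the block has been traversed along `θ`. -/
noncomputable def model (L : TreeLayout S A d k) {η : ℝ} (B : HiddenCorrelation M d η)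
    (θ : Fin (d * (k + 1)) → A) : RMMDP S A binary M where
  reward_bounded := fun z hz => by
    simp only [binary, Finset.mem_insert, Finset.mem_singleton] at hz
    rcases hz with rfl | rfl <;> simp
  init := PMF.pure L.root
  trans := fun s a => PMF.pure (L.next s a)
  weight := B.weight
  reward := fun m s a =>
    if ∃ i w, s = L.code (exitTime i) w then coin (L.secretBias θ (B.bias m) s a)
    else PMF.pure binaryZero

/-- The word of the actions of a trajectory. -/
def actions {H : ℕ} (τ : Trajectory S A binary H) : Fin H → A := fun t => (τ t).2.1

lemma state_eq_code (L : TreeLayout S A d k) {π : RandomizedPolicy S A binary}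
    {τ : Trajectory S A binary (d * (k + 1))}
    (hτ : policyWeight L.next π (d * (k + 1)) [] L.root τ ≠ 0) (t : Fin (d * (k + 1))) :
    (τ t).1 = L.code t (actions τ) := by
  obtain ⟨h0, h1⟩ := follows_of_policyWeight_ne_zero hτ
  obtain ⟨t, ht⟩ := t
  induction t with
  | zero => rw [h0 ht, L.code_zero]
  | succ t ih =>
    rw [h1 t ht, ih (by omega)]
    exact L.next_code ⟨t, _⟩ (actions τ) ht

open Classical in
/-- The reference law of the reward at time `t`: a fair coin at the end of a block and `0`
elsewhere. -/
noncomputable def refCoin (d k : ℕ) (t : Fin (d * (k + 1))) (z : binary) : ℝ :=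
  if k + 1 ∣ (t : ℕ) + 1 then 1 / 2 else if z = binaryZero then 1 else 0

/-- The probability of a sequence of rewards when no block is biased. -/
noncomputable def refReward (d k : ℕ) (z : Fin (d * (k + 1)) → binary) : ℝ :=
  ∏ t, refCoin d k t (z t)

/-- The reference law of an episode: all coins are fair. -/
noncomputable def refLaw (L : TreeLayout S A d k) (π : RandomizedPolicy S A binary)
    (τ : Trajectory S A binary (d * (k + 1))) : ℝ :=
  policyWeight L.next π (d * (k + 1)) [] L.root τ * refReward d k fun t => (τ t).2.2

/-- The product of the signs of the rewards at the ends of the blocks. -/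
noncomputable def blockSign (z : Fin (d * (k + 1)) → binary) : ℝ :=
  ∏ i, rewardSign (z (exitTime i))

open Classical in
/-- The perturbation of the reference law in the model with the secret word `θ`. -/
noncomputable def perturbation (θ : Fin (d * (k + 1)) → A)
    (τ : Trajectory S A binary (d * (k + 1))) : ℝ :=
  if actions τ = θ then blockSign fun t => (τ t).2.2 else 0

lemma exitTime_div (i : Fin d) (j : Fin (k + 1)) :
    ((finProdFinEquiv (i, j) : Fin (d * (k + 1))) : ℕ) / (k + 1) = i := by
  simp only [finProdFinEquiv_apply_val]
  rw [Nat.add_mul_div_left _ _ k.succ_pos, Nat.div_eq_of_lt j.2, Nat.zero_add]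

lemma exitTime_injective : Function.Injective (exitTime : Fin d → Fin (d * (k + 1))) :=
  fun _ _ h => (Prod.mk.inj (finProdFinEquiv.injective h)).1

/-- The end of the block `i` is biased along `w` iff the whole block of `w` agrees with `θ`. -/
lemma code_exit_eq_iff (L : TreeLayout S A d k) (i : Fin d) (w θ : Fin (d * (k + 1)) → A) :
    (L.code (exitTime i) w = L.code (exitTime i) θ ∧ w (exitTime i) = θ (exitTime i)) ↔
      ∀ j, w (finProdFinEquiv (i, j)) = θ (finProdFinEquiv (i, j)) := by
  constructor
  · rintro ⟨h1, h2⟩ j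
    rcases eq_or_ne j (Fin.last k) with rfl | hj
    · exact h2
    · refine ((L.code_eq_iff _ _ _ _).1 h1).2 _ ?_ ?_
      · rw [exitTime, Fin.lt_def]
        simp only [finProdFinEquiv_apply_val, Fin.val_last]
        have := Fin.lt_last_iff_ne_last.2 hj
        rw [Fin.lt_def, Fin.val_last] at this
        omega
      · rw [exitTime, exitTime_div, exitTime_div]
  · intro h
    refine ⟨(L.code_eq_iff _ _ _ _).2 ⟨rfl, fun t _ hb => ?_⟩, h (Fin.last k)⟩
    obtain ⟨⟨i', j⟩, rfl⟩ := finProdFinEquiv.surjective t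
    rw [exitTime, exitTime_div, exitTime_div] at hb
    rw [Fin.ext hb]
    exact h j

open Classical in
lemma secretBias_exit (L : TreeLayout S A d k) (θ w : Fin (d * (k + 1)) → A) (y : Fin d → ℝ)
    (i : Fin d) : L.secretBias θ y (L.code (exitTime i) w) (w (exitTime i)) =
      if ∀ j, w (finProdFinEquiv (i, j)) = θ (finProdFinEquiv (i, j)) then y i else 0 := by
  have key : ∀ i' : Fin d, (L.code (exitTime i) w = L.code (exitTime i') θ ∧
      w (exitTime i) = θ (exitTime i')) → i' = i := fun i' h =>
    (exitTime_injective ((L.code_eq_iff _ _ _ _).1 h.1).1).symm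
  rw [secretBias]
  split_ifs with h1 h2 h2
  · rw [key _ h1.choose_spec]
  · obtain ⟨i', hi'⟩ := h1
    obtain rfl := key _ hi'
    exact absurd ((L.code_exit_eq_iff _ _ _).1 hi') h2
  · exact absurd ⟨i, (L.code_exit_eq_iff _ _ _).2 h2⟩ h1
  · rfl

lemma exists_exitTime {t : Fin (d * (k + 1))} (ht : k + 1 ∣ (t : ℕ) + 1) :
    ∃ i, t = exitTime i := by
  obtain ⟨⟨i, j⟩, rfl⟩ := finProdFinEquiv.surjective t
  refine ⟨i, ?_⟩
  rw [exitTime]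
  congr 2
  simp only [finProdFinEquiv_apply_val] at ht
  have h1 : k + 1 ∣ (j : ℕ) + 1 := by
    have h2 : (j : ℕ) + (k + 1) * i + 1 = (j + 1) + (k + 1) * i := by ring
    rw [h2] at ht
    exact (Nat.dvd_add_left (dvd_mul_right _ _)).1 ht
  have := Nat.le_of_dvd (Nat.succ_pos _) h1
  have := j.2
  exact Fin.ext (by simp; omega)

lemma dvd_exitTime (i : Fin d) : k + 1 ∣ ((exitTime i : Fin (d * (k + 1))) : ℕ) + 1 := by
  simp only [exitTime, finProdFinEquiv_apply_val, Fin.val_last]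
  exact ⟨i + 1, by ring⟩

/-- The moments of the biases annihilate every proper subset of the blocks. -/
lemma sum_weight_mul_prod {η : ℝ} (hd : 0 < d) (B : HiddenCorrelation M d η) (c : Fin d → ℝ) :
    ∑ m, (B.weight m).toReal * ∏ i, (1 + B.bias m i * c i) = 1 + η * ∏ i, c i := by
  classical
  have : Nonempty (Fin d) := ⟨⟨0, hd⟩⟩
  simp only [Finset.prod_one_add, Finset.prod_mul_distrib, Finset.mul_sum, ← mul_assoc]
  rw [Finset.sum_comm]
  simp only [← Finset.sum_mul, B.moment, Finset.powerset_univ]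
  rw [← Finset.add_sum_erase _ _ (Finset.mem_univ ∅), ← Finset.add_sum_erase _ _
    (Finset.mem_erase.2 ⟨Finset.univ_nonempty.ne_empty, Finset.mem_univ Finset.univ⟩),
    Finset.sum_eq_zero]
  · simp [Finset.univ_nonempty.ne_empty]
  · intro T hT
    simp only [Finset.mem_erase] at hT
    rw [if_neg hT.2.1, if_neg hT.1, zero_mul]

/-- The episodes of the model have density `1 + η * perturbation` with respect to the reference
law. -/
lemma episode_model_toReal (L : TreeLayout S A d k) (hd : 0 < d) {η : ℝ}
    (B : HiddenCorrelation M d η) (θ : Fin (d * (k + 1)) → A) (π : RandomizedPolicy S A binary)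
    (τ : Trajectory S A binary (d * (k + 1))) :
    ((L.model B θ).episode (d * (k + 1)) π τ).toReal =
      L.refLaw π τ * (1 + η * perturbation θ τ) := by
  classical
  rw [episode_toReal (s₀ := L.root) (next := L.next) rfl (fun _ _ => rfl), refLaw, mul_assoc]
  by_cases hτ : policyWeight L.next π (d * (k + 1)) [] L.root τ = 0
  · rw [hτ, zero_mul, zero_mul]
  congr 1
  have hst := L.state_eq_code hτ
  -- `c i` is the sign of the reward at the end of the block `i` if that block is biased
  set c : Fin d → ℝ := fun i =>
    if ∀ j, actions τ (finProdFinEquiv (i, j)) = θ (finProdFinEquiv (i, j)) then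
      rewardSign (τ (exitTime i)).2.2 else 0 with hc
  have hrew : ∀ m t, ((L.model B θ).reward m (τ t).1 (τ t).2.1 (τ t).2.2).toReal =
      refCoin d k t (τ t).2.2 * if k + 1 ∣ (t : ℕ) + 1 then
        1 + L.secretBias θ (B.bias m) (τ t).1 (τ t).2.1 * rewardSign (τ t).2.2 else 1 := by
    intro m t
    simp only [model, refCoin]
    by_cases ht : k + 1 ∣ (t : ℕ) + 1
    · obtain ⟨i, rfl⟩ := exists_exitTime ht
      rw [if_pos ⟨i, _, hst _⟩, if_pos ht, if_pos ht, coin_toReal]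
      · ring
      · rw [hst]
        refine le_of_eq_of_le (congrArg abs (L.secretBias_exit θ (actions τ) (B.bias m) i)) ?_
        split_ifs
        · exact B.abs_bias_le m i
        · simp
    · rw [if_neg, if_neg ht, if_neg ht, PMF.pure_apply]
      · split_ifs <;> simp
      · rintro ⟨_, w, h⟩
        rw [hst, L.code_eq_iff] at h
        exact ht (h.1 ▸ dvd_exitTime _)
  have hprod : ∀ m, ∏ t, ((L.model B θ).reward m (τ t).1 (τ t).2.1 (τ t).2.2).toReal =
      refReward d k (fun t => (τ t).2.2) * ∏ i, (1 + B.bias m i * c i) := by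
    intro m
    simp only [hrew, Finset.prod_mul_distrib]
    rw [prod_exit, refReward]
    congr 1
    refine Finset.prod_congr rfl fun i _ => ?_
    rw [hst]
    refine (congrArg (fun b => 1 + b * rewardSign (τ (exitTime i)).2.2)
      (L.secretBias_exit θ (actions τ) (B.bias m) i)).trans ?_
    simp only [hc]
    split_ifs <;> simp
  have hcprod : ∏ i, c i = perturbation θ τ := by
    rw [perturbation]
    split_ifs with h
    · rw [blockSign]
      refine Finset.prod_congr rfl fun i _ => ?_
      rw [hc]
      dsimp only
      rw [if_pos fun j => congrFun h _]
    · have : ∃ i, ¬ ∀ j, actions τ (finProdFinEquiv (i, j)) = θ (finProdFinEquiv (i, j)) := by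
        by_contra! h'
        refine h (funext fun t => ?_)
        obtain ⟨⟨i, j⟩, rfl⟩ := finProdFinEquiv.surjective t
        exact h' i j
      obtain ⟨i, hi⟩ := this
      exact Finset.prod_eq_zero (Finset.mem_univ i) (by rw [hc]; exact if_neg hi)
  simp only [hprod, mul_left_comm _ (refReward d k _)]
  rw [← Finset.mul_sum]
  congr 1
  exact (sum_weight_mul_prod hd B c).trans (by rw [hcprod])

end TreeLayout

namespace TreeLayout

/-! ### The value of a policy in the hard models -/

section Value

variable {S A : Type} {d k M : ℕ}

lemma refCoin_nonneg (t : Fin (d * (k + 1))) (z : binary) : 0 ≤ refCoin d k t z := by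
  unfold refCoin
  split_ifs <;> norm_num

lemma refReward_nonneg (z : Fin (d * (k + 1)) → binary) : 0 ≤ refReward d k z :=
  Finset.prod_nonneg fun _ _ => refCoin_nonneg _ _

lemma sum_refCoin (t : Fin (d * (k + 1))) : ∑ z, refCoin d k t z = 1 := by
  rw [sum_binary]
  unfold refCoin
  split_ifs <;> simp_all [binaryZero_ne_binaryOne.symm]
  norm_num

lemma sum_refReward (d k : ℕ) : ∑ z, refReward d k z = 1 := by
  have h := Finset.prod_univ_sum (fun _ : Fin (d * (k + 1)) => (Finset.univ : Finset binary))
    (fun t z => refCoin d k t z)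
  simp only [sum_refCoin, Finset.prod_const_one, Fintype.piFinset_univ] at h
  exact h.symm

lemma refLaw_nonneg (L : TreeLayout S A d k) (π : RandomizedPolicy S A binary)
    (τ : Trajectory S A binary (d * (k + 1))) : 0 ≤ L.refLaw π τ :=
  mul_nonneg (policyWeight_nonneg _ _ _ _ _ _) (refReward_nonneg _)

/-- Under the reference law the distribution of the rewards does not depend on the policy. -/
lemma sum_refLaw_mul [Fintype S] [Fintype A] (L : TreeLayout S A d k)
    (π : RandomizedPolicy S A binary) (g : (Fin (d * (k + 1)) → binary) → ℝ) :
    ∑ τ, L.refLaw π τ * g (fun t => (τ t).2.2) = ∑ z, refReward d k z * g z := by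
  simp only [refLaw, mul_assoc]
  exact sum_policyWeight_mul L.next π _ [] L.root fun z => refReward d k z * g z

lemma sum_refLaw [Fintype S] [Fintype A] (L : TreeLayout S A d k)
    (π : RandomizedPolicy S A binary) : ∑ τ, L.refLaw π τ = 1 := by
  simpa [sum_refReward] using L.sum_refLaw_mul π fun _ => 1

/-- The product of the signs of the rewards at the ends of all blocks but the last. -/
noncomputable def earlySign (z : Fin ((d + 1) * (k + 1)) → binary) : ℝ :=
  ∏ i : Fin d, rewardSign (z (exitTime i.castSucc))

lemma blockSign_eq (z : Fin ((d + 1) * (k + 1)) → binary) :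
    blockSign z = earlySign z * rewardSign (z (exitTime (Fin.last d))) := by
  rw [blockSign, Fin.prod_univ_castSucc, earlySign]

lemma rewardSign_eq (z : binary) : rewardSign z = 1 ∨ rewardSign z = -1 := by
  rcases binary_cases z with rfl | rfl <;> simp

lemma earlySign_eq (z : Fin ((d + 1) * (k + 1)) → binary) :
    earlySign z = 1 ∨ earlySign z = -1 := by
  unfold earlySign
  refine Finset.prod_induction _ (fun x : ℝ => x = 1 ∨ x = -1) ?_ (Or.inl rfl)
    fun i _ => rewardSign_eq _
  rintro a b (rfl | rfl) (rfl | rfl) <;> simp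

lemma lastTime_succ : ((exitTime (Fin.last d) : Fin ((d + 1) * (k + 1))) : ℕ) + 1 =
    (d + 1) * (k + 1) := by
  simp only [exitTime, finProdFinEquiv_apply_val, Fin.val_last]
  ring

lemma exitTime_lt_last (i : Fin d) : ((exitTime i.castSucc : Fin ((d + 1) * (k + 1))) : ℕ) <
    (exitTime (Fin.last d) : Fin ((d + 1) * (k + 1))) := by
  simp only [exitTime, finProdFinEquiv_apply_val, Fin.val_last, Fin.val_castSucc]
  have := Nat.mul_lt_mul_of_pos_left i.2 k.succ_pos
  simp only [Nat.succ_eq_add_one] at this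
  omega

/-- The probability, under fair coins, that the blocks before the last leave a positive sign. -/
noncomputable def positiveMass (d k : ℕ) : ℝ :=
  open Classical in ∑ z : Fin ((d + 1) * (k + 1)) → binary,
    refReward (d + 1) k z * if earlySign z = 1 then 1 else 0

lemma half_le_positiveMass (d k : ℕ) : 1 / 2 ≤ positiveMass d k := by
  classical
  have h1 : 0 ≤ ∑ z : Fin ((d + 1) * (k + 1)) → binary, refReward (d + 1) k z * earlySign z := by
    set last : Fin ((d + 1) * (k + 1)) := exitTime (Fin.last d) with hlast
    have h2 : ∀ z : Fin ((d + 1) * (k + 1)) → binary, refReward (d + 1) k z * earlySign z =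
        ∏ t, (refCoin (d + 1) k t (z t) * if k + 1 ∣ (t : ℕ) + 1 then
          (if t = last then 1 else rewardSign (z t)) else 1) := by
      intro z
      rw [Finset.prod_mul_distrib, prod_exit fun t => if t = last then 1 else rewardSign (z t),
        Fin.prod_univ_castSucc, if_pos hlast.symm, mul_one, refReward, earlySign]
      congr 1
      refine Finset.prod_congr rfl fun i _ => ?_
      rw [if_neg]
      intro h
      exact (exitTime_lt_last (k := k) i).ne (congrArg Fin.val h)
    have h3 := Finset.prod_univ_sum
      (fun _ : Fin ((d + 1) * (k + 1)) => (Finset.univ : Finset binary))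
      (fun t b => refCoin (d + 1) k t b * if k + 1 ∣ (t : ℕ) + 1 then
          (if t = last then 1 else rewardSign b) else 1)
    rw [Fintype.piFinset_univ] at h3
    simp only [h2]
    rw [← h3]
    -- each factor is `0` (a fair coin weighted by its sign) or `1`
    refine Finset.prod_nonneg fun t _ => ?_
    rw [sum_binary]
    unfold refCoin
    split_ifs <;> simp_all
  have h4 : positiveMass d k = (∑ z : Fin ((d + 1) * (k + 1)) → binary, refReward (d + 1) k z +
      ∑ z : Fin ((d + 1) * (k + 1)) → binary, refReward (d + 1) k z * earlySign z) / 2 := by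
    rw [← Finset.sum_add_distrib, Finset.sum_div, positiveMass]
    refine Finset.sum_congr rfl fun z _ => ?_
    rcases earlySign_eq z with h | h
    · rw [if_pos h, h]; ring
    · rw [if_neg (by rw [h]; norm_num), h]; ring
  rw [h4, sum_refReward]
  linarith

open Classical in
/-- The reference probability of following the secret word `θ`, counted with the sign of the blocks
before the last. -/
noncomputable def advantage (L : TreeLayout S A (d + 1) k) [Fintype S] [Fintype A]
    (θ : Fin ((d + 1) * (k + 1)) → A) (π : RandomizedPolicy S A binary) : ℝ :=
  ∑ τ, L.refLaw π τ * if actions τ = θ then earlySign (fun t => (τ t).2.2) else 0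

/-- Flip the reward at the end of the last block. -/
noncomputable def flipLast (τ : Trajectory S A binary ((d + 1) * (k + 1))) :
    Trajectory S A binary ((d + 1) * (k + 1)) :=
  Function.update τ (exitTime (Fin.last d)) ((τ (exitTime (Fin.last d))).1,
    (τ (exitTime (Fin.last d))).2.1, flipReward (τ (exitTime (Fin.last d))).2.2)

lemma flipLast_of_ne (τ : Trajectory S A binary ((d + 1) * (k + 1)))
    {t : Fin ((d + 1) * (k + 1))} (ht : t ≠ exitTime (Fin.last d)) : flipLast τ t = τ t :=
  Function.update_of_ne ht _ _

lemma flipLast_last (τ : Trajectory S A binary ((d + 1) * (k + 1))) :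
    flipLast τ (exitTime (Fin.last d)) = ((τ (exitTime (Fin.last d))).1,
      (τ (exitTime (Fin.last d))).2.1, flipReward (τ (exitTime (Fin.last d))).2.2) :=
  Function.update_self _ _ _

lemma flipLast_flipLast (τ : Trajectory S A binary ((d + 1) * (k + 1))) :
    flipLast (flipLast τ) = τ := by
  funext t
  by_cases ht : t = exitTime (Fin.last d)
  · subst ht
    rw [flipLast_last, flipLast_last, flipReward_flipReward]
  · rw [flipLast_of_ne _ ht, flipLast_of_ne _ ht]

lemma flipLast_state (τ : Trajectory S A binary ((d + 1) * (k + 1)))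
    (t : Fin ((d + 1) * (k + 1))) : (flipLast τ t).1 = (τ t).1 := by
  by_cases ht : t = exitTime (Fin.last d)
  · subst ht; rw [flipLast_last]
  · rw [flipLast_of_ne _ ht]

lemma flipLast_action (τ : Trajectory S A binary ((d + 1) * (k + 1)))
    (t : Fin ((d + 1) * (k + 1))) : (flipLast τ t).2.1 = (τ t).2.1 := by
  by_cases ht : t = exitTime (Fin.last d)
  · subst ht; rw [flipLast_last]
  · rw [flipLast_of_ne _ ht]

lemma refLaw_flipLast (L : TreeLayout S A (d + 1) k) (π : RandomizedPolicy S A binary)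
    (τ : Trajectory S A binary ((d + 1) * (k + 1))) : L.refLaw π (flipLast τ) = L.refLaw π τ := by
  rw [refLaw, refLaw]
  congr 1
  · refine policyWeight_congr (flipLast_state τ) (flipLast_action τ) fun t ht => ?_
    refine flipLast_of_ne τ ?_
    rintro rfl
    exact ht.ne lastTime_succ
  · refine Finset.prod_congr rfl fun t _ => ?_
    by_cases ht : t = exitTime (Fin.last d)
    · subst ht
      rw [refCoin, refCoin, if_pos (dvd_exitTime _), if_pos (dvd_exitTime _)]
    · simp only [flipLast_of_ne _ ht]

lemma earlySign_flipLast (τ : Trajectory S A binary ((d + 1) * (k + 1))) :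
    earlySign (fun t => (flipLast τ t).2.2) = earlySign fun t => (τ t).2.2 := by
  refine Finset.prod_congr rfl fun i _ => ?_
  dsimp only
  rw [flipLast_of_ne]
  exact fun h => (exitTime_lt_last (k := k) i).ne (congrArg Fin.val h)

lemma rewardSign_mul_sum_flipLast (τ : Trajectory S A binary ((d + 1) * (k + 1))) :
    rewardSign (τ (exitTime (Fin.last d))).2.2 * ∑ t, ((τ t).2.2 : ℝ) +
      rewardSign (flipLast τ (exitTime (Fin.last d))).2.2 * ∑ t, ((flipLast τ t).2.2 : ℝ) = 1 := by
  have h : ∑ t ∈ Finset.univ.erase (exitTime (Fin.last d)), ((flipLast τ t).2.2 : ℝ) =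
      ∑ t ∈ Finset.univ.erase (exitTime (Fin.last d)), ((τ t).2.2 : ℝ) :=
    Finset.sum_congr rfl fun t ht => by rw [flipLast_of_ne _ (Finset.ne_of_mem_erase ht)]
  rw [← Finset.add_sum_erase _ _ (Finset.mem_univ (exitTime (Fin.last d))),
    ← Finset.add_sum_erase (a := exitTime (Fin.last d)) _ (fun t => ((flipLast τ t).2.2 : ℝ))
      (Finset.mem_univ _), h, flipLast_last]
  generalize ∑ t ∈ Finset.univ.erase (exitTime (Fin.last d)), ((τ t).2.2 : ℝ) = r
  have h0 : (binaryZero : ℝ) = 0 := rfl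
  have h1 : (binaryOne : ℝ) = 1 := rfl
  rcases binary_cases (τ (exitTime (Fin.last d))).2.2 with h | h <;> rw [h] <;>
    simp [h0, h1]

/-- The perturbation changes the value only through the last reward: averaging over the last coin
replaces the total reward, weighted with the sign of all blocks, by half the sign of the blocks
before the last. -/
lemma sum_refLaw_mul_perturbation (L : TreeLayout S A (d + 1) k) [Fintype S] [Fintype A]
    (θ : Fin ((d + 1) * (k + 1)) → A) (π : RandomizedPolicy S A binary) :
    ∑ τ, L.refLaw π τ * (perturbation θ τ * ∑ t, ((τ t).2.2 : ℝ)) = L.advantage θ π / 2 := by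
  classical
  have hflip : ∑ τ, L.refLaw π τ * (perturbation θ τ * ∑ t, ((τ t).2.2 : ℝ)) =
      ∑ τ, L.refLaw π (flipLast τ) *
        (perturbation θ (flipLast τ) * ∑ t, ((flipLast τ t).2.2 : ℝ)) :=
    (Equiv.sum_comp (Function.Involutive.toPerm flipLast flipLast_flipLast)
      fun τ => L.refLaw π τ * (perturbation θ τ * ∑ t, ((τ t).2.2 : ℝ))).symm
  have htwo : ∑ τ, L.refLaw π τ * (perturbation θ τ * ∑ t, ((τ t).2.2 : ℝ)) +
      ∑ τ, L.refLaw π (flipLast τ) *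
        (perturbation θ (flipLast τ) * ∑ t, ((flipLast τ t).2.2 : ℝ)) = L.advantage θ π := by
    rw [← Finset.sum_add_distrib, advantage]
    refine Finset.sum_congr rfl fun τ _ => ?_
    have hact : actions (flipLast τ) = actions τ := funext fun t => flipLast_action τ t
    rw [refLaw_flipLast, perturbation, perturbation, hact, ← mul_add]
    congr 1
    split_ifs
    · rw [blockSign_eq, blockSign_eq, earlySign_flipLast, mul_assoc, mul_assoc, ← mul_add,
        rewardSign_mul_sum_flipLast, mul_one]
    · simp
  linarith

/-- The value of every policy without the perturbation. -/
noncomputable def baseValue (d k : ℕ) : ℝ :=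
  ∑ z : Fin (d * (k + 1)) → binary, refReward d k z * ∑ t, (z t : ℝ)

lemma value_model (L : TreeLayout S A (d + 1) k) [Fintype S] [Fintype A] {η : ℝ}
    (B : HiddenCorrelation M (d + 1) η) (θ : Fin ((d + 1) * (k + 1)) → A)
    (π : Policy S A binary) :
    (L.model B θ).value ((d + 1) * (k + 1)) π =
      baseValue (d + 1) k + η / 2 * L.advantage θ π.toRandomized := by
  have h := L.sum_refLaw_mul_perturbation θ π.toRandomized
  have h2 := L.sum_refLaw_mul π.toRandomized fun z => ∑ t, (z t : ℝ)
  rw [RMMDP.value]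
  simp only [L.episode_model_toReal d.succ_pos B]
  have h3 : ∀ τ, L.refLaw π.toRandomized τ * (1 + η * perturbation θ τ) *
      ∑ t, ((τ t).2.2 : ℝ) = L.refLaw π.toRandomized τ * (∑ t, ((τ t).2.2 : ℝ)) +
        η * (L.refLaw π.toRandomized τ * (perturbation θ τ * ∑ t, ((τ t).2.2 : ℝ))) :=
    fun τ => by ring
  simp only [h3, Finset.sum_add_distrib, ← Finset.mul_sum]
  rw [h, h2, baseValue]
  ring

lemma ite_earlySign_le (p : Prop) [Decidable p] (z : Fin ((d + 1) * (k + 1)) → binary) :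
    (if p then earlySign z else 0) ≤ if earlySign z = 1 then (1 : ℝ) else 0 := by
  by_cases hz : earlySign z = 1
  · rw [if_pos hz, hz]
    split_ifs <;> norm_num
  · rw [if_neg hz, (earlySign_eq z).resolve_left hz]
    split_ifs <;> norm_num

/-- A policy cannot have a large advantage for two secret words at once. -/
lemma advantage_add_le (L : TreeLayout S A (d + 1) k) [Fintype S] [Fintype A]
    {θ θ' : Fin ((d + 1) * (k + 1)) → A} (hne : θ ≠ θ') (π : RandomizedPolicy S A binary) :
    L.advantage θ π + L.advantage θ' π ≤ positiveMass d k := by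
  classical
  rw [positiveMass, ← L.sum_refLaw_mul π, advantage, advantage, ← Finset.sum_add_distrib]
  refine Finset.sum_le_sum fun τ _ => ?_
  rw [← mul_add]
  refine mul_le_mul_of_nonneg_left ?_ (L.refLaw_nonneg π τ)
  by_cases h1 : actions τ = θ
  · rw [if_pos h1, if_neg (fun h2 => hne (h1.symm.trans h2)), add_zero]
    simpa using ite_earlySign_le True fun t => (τ t).2.2
  · rw [if_neg h1, zero_add]
    exact ite_earlySign_le _ _

lemma advantage_le (L : TreeLayout S A (d + 1) k) [Fintype S] [Fintype A]
    (θ : Fin ((d + 1) * (k + 1)) → A) (π : RandomizedPolicy S A binary) :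
    L.advantage θ π ≤ positiveMass d k := by
  classical
  rw [positiveMass, ← L.sum_refLaw_mul π, advantage]
  exact Finset.sum_le_sum fun τ _ =>
    mul_le_mul_of_nonneg_left (ite_earlySign_le _ _) (L.refLaw_nonneg π τ)

open Classical in
/-- The optimal policy for the secret word `θ`: follow `θ`, and leave it with the very last action
if the blocks before the last had a negative sign. -/
noncomputable def secretPolicy [Nontrivial A] (θ : Fin ((d + 1) * (k + 1)) → A) :
    Policy S A binary := fun h _ =>
  if ht : h.length < (d + 1) * (k + 1) then
    if h.length + 1 = (d + 1) * (k + 1) ∧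
        earlySign (d := d) (k := k) (fun t => (h[(t : ℕ)]?.map fun x => x.2.2).getD binaryZero) ≠ 1
    then (exists_ne (θ ⟨h.length, ht⟩)).choose
    else θ ⟨h.length, ht⟩
  else Classical.arbitrary A

lemma advantage_secretPolicy (L : TreeLayout S A (d + 1) k) [Fintype S] [Fintype A]
    [Nontrivial A] (θ : Fin ((d + 1) * (k + 1)) → A) :
    L.advantage θ (secretPolicy (S := S) θ).toRandomized = positiveMass d k := by
  classical
  rw [positiveMass, ← L.sum_refLaw_mul (secretPolicy (S := S) θ).toRandomized, advantage]
  refine Finset.sum_congr rfl fun τ _ => ?_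
  by_cases hτ : policyWeight L.next (secretPolicy (S := S) θ).toRandomized _ [] L.root τ = 0
  · rw [refLaw, hτ]; simp
  congr 1
  have hact := action_eq_of_policyWeight_ne_zero hτ
  have hlen : ∀ t : Fin ((d + 1) * (k + 1)), ((List.ofFn τ).take t).length = t := fun t => by
    rw [List.length_take, List.length_ofFn, min_eq_left t.2.le]
  -- the history before the last action determines the sign
  have hsign : earlySign (d := d) (k := k) (fun t =>
      ((((List.ofFn τ).take (exitTime (k := k) (Fin.last d)))[(t : ℕ)]?).map
        fun x => x.2.2).getD binaryZero) = earlySign fun t => (τ t).2.2 := by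
    refine Finset.prod_congr rfl fun i _ => ?_
    dsimp only
    rw [List.getElem?_take_of_lt (exitTime_lt_last i), List.getElem?_ofFn, dif_pos (Fin.is_lt _)]
    rfl
  by_cases hs : earlySign (fun t => (τ t).2.2) = 1
  · rw [if_pos hs, hs, if_pos]
    funext t
    rw [actions, hact t, List.nil_append, secretPolicy, dif_pos (by rw [hlen]; exact t.2), if_neg]
    · congr 1
      exact Fin.ext (hlen t)
    · rintro ⟨h1, h2⟩
      rw [hlen] at h1
      have ht : t = exitTime (Fin.last d) := Fin.ext (by
        have := lastTime_succ (d := d) (k := k)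
        omega)
      rw [ht, hsign] at h2
      exact h2 hs
  · rw [if_neg hs, if_neg]
    intro h
    have h1 := hact (exitTime (Fin.last d))
    rw [List.nil_append, secretPolicy, dif_pos (by rw [hlen]; exact Fin.is_lt _),
      if_pos ⟨by rw [hlen]; exact lastTime_succ, by rw [hsign]; exact hs⟩] at h1
    refine (exists_ne (θ ⟨_, _⟩)).choose_spec (h1.symm.trans ((congrFun h _).trans ?_))
    congr 1
    exact Fin.ext (hlen _).symm

lemma baseValue_add_le_optimalValue (L : TreeLayout S A (d + 1) k) [Fintype S] [Fintype A]
    [Nontrivial A] {η : ℝ} (hη : 0 ≤ η) (B : HiddenCorrelation M (d + 1) η)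
    (θ : Fin ((d + 1) * (k + 1)) → A) :
    baseValue (d + 1) k + η / 2 * positiveMass d k ≤
      (L.model B θ).optimalValue ((d + 1) * (k + 1)) := by
  rw [← L.advantage_secretPolicy θ, ← L.value_model B θ]
  refine le_ciSup (f := fun π => (L.model B θ).value ((d + 1) * (k + 1)) π) ?_ _
  refine ⟨baseValue (d + 1) k + η / 2 * positiveMass d k, ?_⟩
  rintro _ ⟨π, rfl⟩
  simp only [L.value_model B θ]
  have := L.advantage_le θ π.toRandomized
  gcongr

/-- No policy is `ε`-optimal for two secret words. -/
lemma secret_unique (L : TreeLayout S A (d + 1) k) [Fintype S] [Fintype A]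
    [Nontrivial A] {η ε : ℝ} (hη : 0 ≤ η) (hε : 8 * ε < η) (B : HiddenCorrelation M (d + 1) η)
    {θ θ' : Fin ((d + 1) * (k + 1)) → A} {π : Policy S A binary}
    (h : (L.model B θ).IsEpsOptimal ((d + 1) * (k + 1)) ε π)
    (h' : (L.model B θ').IsEpsOptimal ((d + 1) * (k + 1)) ε π) : θ = θ' := by
  by_contra hne
  have hη2 : 0 ≤ η / 2 := by positivity
  have h1 := L.baseValue_add_le_optimalValue hη B θ
  have h2 := L.baseValue_add_le_optimalValue hη B θ'
  rw [RMMDP.IsEpsOptimal, value_model] at h h'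
  have h3 := mul_le_mul_of_nonneg_left (L.advantage_add_le hne π.toRandomized) hη2
  have h4 := mul_le_mul_of_nonneg_left (half_le_positiveMass d k) hη2
  linarith

/-- A learner that is correct for all secret words needs a number of episodes of the order of the
number of words over the squared correlation. -/
theorem card_words_le (L : TreeLayout S A (d + 1) k) [Fintype S] [Fintype A]
    [Nontrivial A] {η ε : ℝ} (hη0 : 0 < η) (hη : η ≤ 1 / 2) (hε : 8 * ε < η)
    (B : HiddenCorrelation M (d + 1) η) {K : ℕ} (ψ : Learner S A binary ((d + 1) * (k + 1)) K)
    (hψ : ∀ θ, (2 / 3 : ℝ≥0∞) ≤ (ψ.result (L.model B θ)).toOuterMeasure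
      {π | (L.model B θ).IsEpsOptimal ((d + 1) * (k + 1)) ε π}) :
    Real.log (9 / 8) / 2 * (Fintype.card A : ℝ) ^ ((d + 1) * (k + 1)) ≤ η ^ 2 * K := by
  classical
  have hcard : Fintype.card (Fin ((d + 1) * (k + 1)) → A) =
      Fintype.card A ^ ((d + 1) * (k + 1)) := by simp
  have hQ1 : ∀ π, ∑ τ, L.refLaw π τ = 1 := L.sum_refLaw
  have habs : ∀ (θ : Fin ((d + 1) * (k + 1)) → A) (τ : Trajectory S A binary _),
      |perturbation θ τ| = if actions τ = θ then 1 else 0 := by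
    intro θ τ
    rw [perturbation]
    split_ifs
    · rw [blockSign_eq]
      rcases earlySign_eq (fun t => (τ t).2.2) with h | h <;>
        rcases rewardSign_eq (τ (exitTime (Fin.last d))).2.2 with h' | h' <;> rw [h, h'] <;> simp
    · simp
  have h := card_le_of_tests (Θ := Fin ((d + 1) * (k + 1)) → A)
    (Q := fun p => L.refLaw (ψ.explore p)) (g := perturbation) (η := η) (K := K)
    (φ := fun θ D => ((ψ.output D).toOuterMeasure
      {π | (L.model B θ).IsEpsOptimal ((d + 1) * (k + 1)) ε π}).toReal)
    ?_ (fun p => L.refLaw_nonneg _) (fun p => hQ1 _) ?_ ?_ hη0.le hη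
    (fun _ _ => ENNReal.toReal_nonneg) ?_ ?_
  · rw [hcard] at h
    exact_mod_cast h
  · rw [hcard]
    exact (Nat.succ_le_of_lt (Fintype.one_lt_card (α := A))).trans
      (Nat.le_self_pow (Nat.mul_ne_zero d.succ_ne_zero k.succ_ne_zero) _)
  · intro τ
    simp [habs]
  · -- the perturbation is centred because both laws are probability measures
    intro θ p
    have h1 : ∑ τ, ((L.model B θ).episode ((d + 1) * (k + 1)) (ψ.explore p) τ).toReal = 1 := by
      rw [← ENNReal.toReal_sum fun τ _ => PMF.apply_ne_top _ _,
        ← tsum_fintype (L := .unconditional _), PMF.tsum_coe, ENNReal.toReal_one]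
    simp only [L.episode_model_toReal d.succ_pos B, mul_add, mul_one, Finset.sum_add_distrib,
      hQ1, mul_left_comm _ η, ← Finset.mul_sum] at h1
    have h2 : η * ∑ τ, L.refLaw (ψ.explore p) τ * perturbation θ τ = 0 := by linarith
    exact (mul_eq_zero.1 h2).resolve_left hη0.ne'
  · intro D
    exact sum_toOuterMeasure_toReal_le_one (ψ.output D) _
      fun π θ θ' h1 h2 => L.secret_unique hη0.le hε B h1 h2
  · intro θ
    have h1 := ENNReal.toReal_mono
      (ne_top_of_le_ne_top ENNReal.one_ne_top (toOuterMeasure_le_one _ _)) (hψ θ)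
    rw [result_toReal] at h1
    simp only [collect_toReal (L.episode_model_toReal d.succ_pos B θ) ψ] at h1
    simpa using h1

end Value
end TreeLayout

/-! ### Choice of the parameters -/

section Parameters

lemma sum_range_pow_add_one_le {A : ℕ} (hA : 2 ≤ A) (k : ℕ) :
    ∑ j ∈ Finset.range (k + 1), A ^ j + 1 ≤ 2 * A ^ k := by
  induction k with
  | zero => simp
  | succ k ih =>
    rw [Finset.sum_range_succ, pow_succ]
    nlinarith [Nat.pow_pos (n := k) (show 0 < A by omega)]

/-- With the depth `Nat.log A ((S / d + 1) / 2) + 1` the blocks fit into `S` states. -/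
lemma sum_pow_mod_le {S A d : ℕ} (hA : 2 ≤ A) (hd : 0 < d) (hdS : d ≤ S) :
    ∑ t : Fin (d * (Nat.log A ((S / d + 1) / 2) + 1)),
      A ^ ((t : ℕ) % (Nat.log A ((S / d + 1) / 2) + 1)) ≤ S := by
  have h1 : 1 ≤ S / d := Nat.div_pos hdS hd
  set q := (S / d + 1) / 2 with hq
  have hq0 : q ≠ 0 := by omega
  set k := Nat.log A q with hk
  have hpow : A ^ k ≤ q := Nat.pow_log_le_self A hq0
  rw [← finProdFinEquiv.sum_comp, Fintype.sum_prod_type]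
  have h2 : ∀ (i : Fin d) (j : Fin (k + 1)),
      ((finProdFinEquiv (i, j) : Fin (d * (k + 1))) : ℕ) % (k + 1) = j := fun i j => by
    rw [finProdFinEquiv_apply_val, Nat.add_mul_mod_self_left, Nat.mod_eq_of_lt j.2]
  simp only [h2]
  rw [Finset.sum_const, Finset.card_univ, Fintype.card_fin, smul_eq_mul,
    ← Finset.sum_range fun j => A ^ j]
  have h3 := sum_range_pow_add_one_le hA k
  calc d * ∑ j ∈ Finset.range (k + 1), A ^ j ≤ d * (S / d) := Nat.mul_le_mul_left _ (by omega)
    _ ≤ S := Nat.mul_div_le S d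

/-- The number of action words of one block is polynomially large in the number of state-action
pairs. -/
lemma mul_le_pow_six {S A d : ℕ} (hA : 2 ≤ A) (hd : 0 < d) (hS : 0 < S) (hdSA : d ^ 2 ≤ S * A) :
    S * A ≤ (A ^ (Nat.log A ((S / d + 1) / 2) + 1)) ^ 6 := by
  set n := A ^ (Nat.log A ((S / d + 1) / 2) + 1) with hn
  have h1 : (S / d + 1) / 2 < n := Nat.lt_pow_succ_log_self (by omega) _
  have h2 : A ≤ n := Nat.le_self_pow (by omega) A
  have h3 : S < d * (S / d + 1) := Nat.lt_mul_div_succ S hd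
  have h4 : S ≤ d * (2 * n) := h3.le.trans (Nat.mul_le_mul_left _ (by omega))
  have h5 : S * A ≤ d * (2 * n ^ 2) := by
    calc S * A ≤ d * (2 * n) * n := Nat.mul_le_mul h4 h2
      _ = d * (2 * n ^ 2) := by ring
  have h6 : (S * A) * (S * A) ≤ (S * A) * (4 * n ^ 4) := by
    calc (S * A) * (S * A) ≤ (d * (2 * n ^ 2)) * (d * (2 * n ^ 2)) := Nat.mul_le_mul h5 h5
      _ = d ^ 2 * (4 * n ^ 4) := by ring
      _ ≤ (S * A) * (4 * n ^ 4) := Nat.mul_le_mul_right _ hdSA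
  have h7 := Nat.le_of_mul_le_mul_left h6 (Nat.mul_pos hS (by omega))
  calc S * A ≤ 4 * n ^ 4 := h7
    _ ≤ n ^ 2 * n ^ 4 := Nat.mul_le_mul_right _ (by nlinarith)
    _ = n ^ 6 := by ring

lemma rpow_sqrt_le_pow {y n d : ℕ} {x : ℝ} (hy : 1 ≤ y) (hyn : y ≤ n ^ 6) (hx : x ≤ 3 * d) :
    (y : ℝ) ^ (1 / 18 * x) ≤ (n : ℝ) ^ d := by
  have hy1 : (1 : ℝ) ≤ y := by exact_mod_cast hy
  have hyn' : (y : ℝ) ≤ (n : ℝ) ^ 6 := by exact_mod_cast hyn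
  calc (y : ℝ) ^ (1 / 18 * x) ≤ (y : ℝ) ^ ((d : ℝ) / 6) :=
        Real.rpow_le_rpow_of_exponent_le hy1 (by linarith)
    _ ≤ ((n : ℝ) ^ 6) ^ ((d : ℝ) / 6) := Real.rpow_le_rpow (by positivity) hyn' (by positivity)
    _ = (n : ℝ) ^ d := by
        rw [← Real.rpow_natCast, ← Real.rpow_natCast, ← Real.rpow_mul (Nat.cast_nonneg n)]
        congr 1
        push_cast
        ring

/-- The correlations that are available for `d` blocks reach down to the threshold for `ε`. -/
lemma correlation_le {M d : ℕ} {ε : ℝ} (hM : 2 ≤ M) (hd : 1 ≤ d) (hdM : d ^ 2 ≤ M) (hε0 : 0 < ε)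
    (hε : ε < (M : ℝ) ^ (-(6 * √(M : ℝ)))) :
    16 * ε * ((d : ℝ) ^ (d + 1) * 2 ^ (d - 1)) ≤ 1 ∧ 16 * ε ≤ 1 / 2 := by
  have hM1 : (1 : ℝ) ≤ M := by exact_mod_cast (by omega : 1 ≤ M)
  have hdsqrt : (d : ℝ) ≤ √(M : ℝ) := Real.le_sqrt_of_sq_le (by exact_mod_cast hdM)
  have hP : (M : ℝ) ^ (6 * d) ≤ (M : ℝ) ^ (6 * √(M : ℝ)) := by
    rw [← Real.rpow_natCast]
    refine Real.rpow_le_rpow_of_exponent_le hM1 ?_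
    push_cast
    linarith
  rw [Real.rpow_neg (by positivity)] at hε
  have hεP : ε * (M : ℝ) ^ (6 * d) ≤ 1 := by
    have h1 : 0 < (M : ℝ) ^ (6 * √(M : ℝ)) := by positivity
    have h2 := (lt_div_iff₀ h1).1 (by rwa [one_div])
    nlinarith
  have hdle : d ≤ M := le_trans (Nat.le_self_pow two_ne_zero d) hdM
  have h16 : 16 * (d ^ (d + 1) * 2 ^ (d - 1)) ≤ M ^ (6 * d) := by
    calc 16 * (d ^ (d + 1) * 2 ^ (d - 1)) = 2 ^ 4 * (d ^ (d + 1) * 2 ^ (d - 1)) := by norm_num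
      _ ≤ M ^ 4 * (M ^ (d + 1) * M ^ (d - 1)) := by gcongr
      _ = M ^ (4 + (d + 1 + (d - 1))) := by rw [pow_add M 4, pow_add M (d + 1)]
      _ ≤ M ^ (6 * d) := Nat.pow_le_pow_right (by omega) (by omega)
  have h32 : 32 ≤ M ^ (6 * d) := by
    calc 32 ≤ 2 ^ 6 := by norm_num
      _ ≤ M ^ 6 := Nat.pow_le_pow_left hM 6
      _ ≤ M ^ (6 * d) := Nat.pow_le_pow_right (by omega) (by omega)
  have h16' : 16 * ((d : ℝ) ^ (d + 1) * 2 ^ (d - 1)) ≤ (M : ℝ) ^ (6 * d) := by exact_mod_cast h16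
  have h32' : (32 : ℝ) ≤ (M : ℝ) ^ (6 * d) := by exact_mod_cast h32
  constructor <;> nlinarith

/-- An odd number of blocks of the order of the square root of `M`. -/
lemma exists_half_blocks {M : ℕ} (hM : 2 ≤ M) :
    ∃ e : ℕ, (2 * e + 1) ^ 2 ≤ M ∧ √(M : ℝ) ≤ 3 * (2 * e + 1 : ℕ) := by
  have h1 : 1 ≤ Nat.sqrt M := Nat.le_sqrt.2 (by omega)
  refine ⟨(Nat.sqrt M - 1) / 2, ?_, ?_⟩
  · calc (2 * ((Nat.sqrt M - 1) / 2) + 1) ^ 2 ≤ Nat.sqrt M ^ 2 :=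
          Nat.pow_le_pow_left (by omega) 2
      _ ≤ M := Nat.sqrt_le' M
  · have h2 : √(M : ℝ) ≤ Nat.sqrt M + 1 := Real.real_sqrt_le_nat_sqrt_succ
    refine h2.trans ?_
    exact_mod_cast (by omega : Nat.sqrt M + 1 ≤ 3 * (2 * ((Nat.sqrt M - 1) / 2) + 1))

end Parameters
end RewardMixing

theorem mainTheorem3 :
    ∃ C B c c₀ : ℝ, 0 < C ∧ 0 < B ∧ 0 < c ∧ 0 < c₀ ∧
      ∀ M S A : ℕ, 2 ≤ M → 2 ≤ A → M ≤ S ^ 2 → M ≤ S * A →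
        ∃ (H : ℕ) (𝓒 : Set (RewardMixing.RMMDP (Fin S) (Fin A) RewardMixing.binary M)),
          (H : ℝ) ≤ B * √(M : ℝ) * (1 + Real.logb (A : ℝ) (S : ℝ)) ∧
          (∃ (s₀ : Fin S) (next : Fin S → Fin A → Fin S), ∀ 𝓜 ∈ 𝓒,
            𝓜.init = PMF.pure s₀ ∧ ∀ s a, 𝓜.trans s a = PMF.pure (next s a)) ∧
          ∀ ε : ℝ, 0 < ε → ε < (M : ℝ) ^ (-(C * √(M : ℝ))) →
            ∀ (K : ℕ) (ψ : RewardMixing.Learner (Fin S) (Fin A) RewardMixing.binary H K),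
              ψ.IsPAC 𝓒 ε →
                c₀ * ((S : ℝ) * (A : ℝ)) ^ (c * √(M : ℝ)) / ε ^ 2 ≤ (K : ℝ) := by
  have hlog : 0 < Real.log (9 / 8) := Real.log_pos (by norm_num)
  refine ⟨6, 1, 1 / 18, Real.log (9 / 8) / 512, by norm_num, by norm_num, by norm_num,
    by positivity, fun M S A hM hA hMS hMSA => ?_⟩
  obtain ⟨e, hdM, hdsqrt⟩ := RewardMixing.exists_half_blocks hM
  have hdS : 2 * e + 1 ≤ S := (Nat.pow_le_pow_iff_left two_ne_zero).1 (hdM.trans hMS)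
  have hS : 0 < S := by omega
  set k := Nat.log A ((S / (2 * e + 1) + 1) / 2) with hk
  have : Nonempty (Fin A) := ⟨⟨0, by omega⟩⟩
  have : Nontrivial (Fin A) := Fin.nontrivial_iff_two_le.2 hA
  obtain ⟨L⟩ := RewardMixing.TreeLayout.exists_of_sum_le (S := Fin S) (A := Fin A)
    (d := 2 * e + 1) (k := k) (by omega)
    (by simpa using RewardMixing.sum_pow_mod_le hA (by omega) hdS)
  refine ⟨(2 * e + 1) * (k + 1), {𝓜 | ∃ (η : ℝ) (_ : 0 < η)
    (B : RewardMixing.HiddenCorrelation M (2 * e + 1) η) (θ : _), 𝓜 = L.model B θ}, ?_,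
    ⟨L.root, L.next, ?_⟩, fun ε hε0 hε K ψ hψ => ?_⟩
  · have h1 : (k : ℝ) ≤ Real.logb A S := by
      have hq : (S / (2 * e + 1) + 1) / 2 ≤ S := by
        have := Nat.div_le_self S (2 * e + 1)
        omega
      have h2 : k ≤ Nat.log A S := Nat.log_mono_right hq
      have h3 := Real.natLog_le_logb S A
      exact le_trans (by exact_mod_cast h2) h3
    have h2 : ((2 * e + 1 : ℕ) : ℝ) ≤ √(M : ℝ) := Real.le_sqrt_of_sq_le (by exact_mod_cast hdM)
    rw [Nat.cast_mul, one_mul]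
    refine mul_le_mul h2 ?_ (by positivity) (by positivity)
    push_cast
    linarith
  · rintro _ ⟨η, _, B, θ, rfl⟩
    exact ⟨rfl, fun _ _ => rfl⟩
  · -- twice the threshold `8 ε` above which an `ε`-optimal policy reveals the secret word
    obtain ⟨h1, h2⟩ := RewardMixing.correlation_le hM (by omega : 1 ≤ 2 * e + 1) hdM hε0 hε
    obtain ⟨B⟩ := RewardMixing.HiddenCorrelation.exists_of_odd (η := 16 * ε) ⟨e, rfl⟩ hdM
      (by positivity) h1
    have h3 := L.card_words_le (ε := ε) (by positivity) h2 (by linarith) B ψ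
      fun θ => hψ _ ⟨16 * ε, by positivity, B, θ, rfl⟩
    have h4 := RewardMixing.rpow_sqrt_le_pow (Nat.mul_pos hS (by omega : 0 < A))
      (RewardMixing.mul_le_pow_six hA (by omega : 0 < 2 * e + 1) hS (hdM.trans hMSA)) hdsqrt
    rw [Fintype.card_fin, mul_comm (2 * e + 1), pow_mul] at h3
    push_cast at h4
    rw [div_le_iff₀ (by positivity)]
    have h5 := mul_le_mul_of_nonneg_left h4 (by positivity : 0 ≤ Real.log (9 / 8) / 2)
    have h6 := h5.trans h3
    nlinarith
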